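/- All graphs are finite and simple. A graph $G$ is called $r$-critical if $\chi(G)=r$ and every proper subgraph of $G$ has chromatic number less than $r$. Adding a simplicial vertex to a graph means adding one new vertex adjacent to all existing vertices. Let $M$ be the Moser spindle, i.e. the graph on $\{0,\dots,6\}$ with the $11$ edges $01,02,12,15,25,03,04,34,36,46,56$, and let $S$ be the graph on $\{0,\dots,6\}$ with the $12$ edges $01,02,12,03,13,04,24,15,25,36,46,56$. The graphs $M$ and $S$ are not isomorphic, and, up to isomorphism, they are precisely the $4$-critical graphs on seven vertices. For every integer $r\ge 8$ there are, up to isomorphism, precisely two $r$-critical graphs on $r+3$ vertices: the graph obtained from $M$ by adding $r-4$ simplicial vertices, i.e. the join $M\vee K_{r-4}$, and the graph obtained from $S$ by adding $r-4$ simplicial vertices, i.e. the join $S\vee K_{r-4}$. -/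

import Mathlib

namespace SimpleGraph

/-- `G` is `r`-critical: its chromatic number is `r`, and every proper subgraph (obtained by
deleting vertices, edges, or both) has chromatic number less than `r`. -/
def IsColorCritical {V : Type*} (G : SimpleGraph V) (r : ℕ) : Prop :=
  G.chromaticNumber = r ∧ ∀ H : G.Subgraph, H ≠ ⊤ → H.coe.chromaticNumber < r

/-- The join of two graphs: their disjoint union together with all edges between them. -/
def joinGraph {V W : Type*} (G : SimpleGraph V) (H : SimpleGraph W) : SimpleGraph (V ⊕ W) :=
  (G ⊕g H) ⊔ completeBipartiteGraph V W

/-- The graph obtained from `G` by adding `k` new vertices one after another, each adjacent to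
all the vertices present; that is, the join of `G` with the complete graph on `k` vertices. -/
def addSimplicial {V : Type*} (G : SimpleGraph V) (k : ℕ) : SimpleGraph (V ⊕ Fin k) :=
  G.joinGraph (completeGraph (Fin k))

/-- The Moser spindle, with `11` edges: the rhombi `0,1,5,2` and `0,3,6,4` (each with its short
diagonal `12`, `34`) share the vertex `0`, and their opposite corners `5`, `6` are adjacent. -/
def moserSpindle : SimpleGraph (Fin 7) :=
  fromEdgeSet {s(0, 1), s(0, 2), s(1, 2), s(1, 5), s(2, 5),
    s(0, 3), s(0, 4), s(3, 4), s(3, 6), s(4, 6), s(5, 6)}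

/-- The triangle `0,1,2` with a further triangle erected on each of its sides (with apexes
`3`, `4`, `5`), and a vertex `6` adjacent to the three apexes; it has `12` edges. -/
def cappedSun : SimpleGraph (Fin 7) :=
  fromEdgeSet {s(0, 1), s(0, 2), s(1, 2), s(3, 0), s(3, 1), s(4, 0), s(4, 2),
    s(5, 1), s(5, 2), s(6, 3), s(6, 4), s(6, 5)}

end SimpleGraph

/-! Write r = k + 1 and let H be the complement of an r-critical graph G on k + 4 vertices. Three
facts about H follow from criticality. It has no four disjoint edges, since four nonadjacent pairs
of G sharing colours would leave a k-colouring. No closed neighbourhood in H lies in that of an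
H-neighbour, since otherwise one of the two vertices could copy the other's colour. Its maximum
degree is at most three, since a vertex of G sees all k colours of a colouring of the rest.

By exchange arguments on a maximum matching, a graph with these three properties has at most seven
nonisolated vertices (`NoFourDisjoint.card_le`). So all vertices of G outside some set of seven are
universal, and the graph on these seven is not 3-colourable, as private colours for the others would
extend a 3-colouring.

A graph on seven vertices without 3-colouring contains K₄, the 5-wheel, the Moser spindle or the
capped sun (`isContained_of_not_colorable`). An independent triple leads to K₄, the wheel or the sun
through a triangle among the other four vertices. Without such a triple, parity gives a vertex of
degree at least four, and its neighbourhood leads to K₄, the wheel or the spindle.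

The join of the subgraph found with the universal vertices still needs r colours, so by criticality
it is all of G; counting vertices excludes K₄ and the wheel. Conversely, joining with a complete
graph preserves criticality (`IsEdgeCritical.addSimplicial`). The two graphs differ because only the
sun has an independent triple. -/

namespace SimpleGraph

/-! ### Critical graphs and their subgraphs -/

section Critical

variable {V W : Type*} {G : SimpleGraph V} {F : SimpleGraph W} {k : ℕ}

lemma IsColorCritical.not_colorable (h : G.IsColorCritical (k + 1)) : ¬ G.Colorable k := by
  intro hc
  have h1 := chromaticNumber_le_iff_colorable.mpr hc
  rw [h.1] at h1
  have : k + 1 ≤ k := by exact_mod_cast h1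
  omega

lemma IsColorCritical.colorable_coe (h : G.IsColorCritical (k + 1)) {H : G.Subgraph}
    (hH : H ≠ ⊤) : H.coe.Colorable k := by
  have h1 := h.2 H hH
  rw [← chromaticNumber_le_iff_colorable]
  push_cast at h1
  exact Order.le_of_lt_add_one h1

/-- A critical graph is isomorphic to each of its subgraphs of the same chromatic number. -/
lemma IsColorCritical.nonempty_iso (h : G.IsColorCritical (k + 1)) (hF : ¬ F.Colorable k)
    (hFG : F ⊑ G) : Nonempty (G ≃g F) := by
  obtain ⟨f⟩ := hFG
  -- The image of the copy needs more than `k` colours, so it cannot be a proper subgraph.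
  by_cases hH : f.toSubgraph = ⊤
  · have e := f.isoToSubgraph
    rw [hH] at e
    exact ⟨(e.trans Subgraph.topIso).symm⟩
  · exact absurd ((h.colorable_coe hH).of_hom f.isoToSubgraph.toHom) hF

/-- Deleting a vertex from a critical graph leaves a graph with fewer colours. -/
lemma IsColorCritical.exists_coloring_off_vertex (h : G.IsColorCritical (k + 1)) (hk : 0 < k)
    (v : V) : ∃ c : V → Fin k, ∀ a b, a ≠ v → b ≠ v → G.Adj a b → c a ≠ c b := by
  classical
  have hH : (⊤ : G.Subgraph).deleteVerts {v} ≠ ⊤ := by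
    intro heq
    have : v ∈ ((⊤ : G.Subgraph).deleteVerts {v}).verts := by rw [heq]; trivial
    simp at this
  obtain ⟨c⟩ := h.colorable_coe hH
  -- The colour of `v` itself is irrelevant; `0 < k` provides one.
  refine ⟨fun a => if ha : a ≠ v then c ⟨a, by simpa using ha⟩ else ⟨0, hk⟩, ?_⟩
  intro a b ha hb hab
  simp only [ne_eq, ha, not_false_eq_true, dif_pos, hb]
  apply c.valid
  simp [hab, ha, hb]

/-- A criterion for criticality, up to isomorphism. -/
lemma isColorCritical_of_iso (e : G ≃g F) (hF : F.Colorable (k + 1)) (hF' : ¬ F.Colorable k)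
    (hd : ∀ v, ∃ w, F.Adj v w)
    (he : ∀ a b, F.Adj a b → (F.deleteEdges {s(a, b)}).Colorable k) :
    G.IsColorCritical (k + 1) := by
  have hG : ¬ G.Colorable k := fun h => hF' (h.of_hom e.symm.toHom)
  refine ⟨le_antisymm (chromaticNumber_le_iff_colorable.mpr (hF.of_hom e.toHom)) ?_, ?_⟩
  · by_contra! hlt
    push_cast at hlt
    exact hG (chromaticNumber_le_iff_colorable.mp (Order.le_of_lt_add_one hlt))
  · intro H hH
    -- Without isolated vertices, a missing vertex entails a missing edge, so edge deletions
    -- suffice.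
    obtain ⟨a, b, hab, hHab⟩ : ∃ a b, G.Adj a b ∧ ¬ H.Adj a b := by
      by_contra! hcon
      apply hH
      ext x y
      · simp only [Subgraph.verts_top, Set.mem_univ, iff_true]
        obtain ⟨w, hw⟩ := hd (e x)
        have hxw : G.Adj x (e.symm w) := by
          rw [← e.map_adj_iff]; simpa using hw
        exact (hcon _ _ hxw).fst_mem
      · exact ⟨fun h => h.adj_sub, fun h => hcon _ _ (by simpa using h)⟩
    have hc : H.coe.Colorable k := by
      refine (he (e a) (e b) (e.map_adj_iff.mpr hab)).of_hom ⟨fun x => e x, ?_⟩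
      intro x y hxy
      rw [deleteEdges_adj]
      refine ⟨e.map_adj_iff.mpr hxy.adj_sub, ?_⟩
      simp only [Set.mem_singleton_iff, Sym2.eq_iff, EmbeddingLike.apply_eq_iff_eq]
      rintro (⟨h1, h2⟩ | ⟨h1, h2⟩)
      · exact hHab (h1 ▸ h2 ▸ hxy)
      · exact hHab (h1 ▸ h2 ▸ hxy.symm)
    calc H.coe.chromaticNumber ≤ k := chromaticNumber_le_iff_colorable.mpr hc
      _ < ((k + 1 : ℕ) : ℕ∞) := by exact_mod_cast Nat.lt_succ_self k

end Critical

/-! ### Constraints on the complement of a critical graph -/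

section Complement

variable {V : Type*} [Fintype V] {G : SimpleGraph V} {k : ℕ}

/-- In a critical graph no neighbourhood is contained in that of a nonadjacent vertex. -/
lemma IsColorCritical.exists_compl_adj (h : G.IsColorCritical (k + 1)) (hk : 0 < k) {u v : V}
    (huv : Gᶜ.Adj u v) : ∃ w, Gᶜ.Adj v w ∧ w ≠ u ∧ ¬ Gᶜ.Adj u w := by
  classical
  by_contra! hcon
  obtain ⟨c, hc⟩ := h.exists_coloring_off_vertex hk u
  rw [compl_adj] at huv
  -- All neighbours of `u` are neighbours of `v`, so `u` can reuse the colour of `v`.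
  have key : ∀ w, G.Adj u w → c v ≠ c w := by
    intro w hw
    refine hc _ _ huv.1.symm hw.ne' ?_
    by_contra hvw
    have hvw' : v ≠ w := by rintro rfl; exact huv.2 hw
    have := hcon w (by rw [compl_adj]; exact ⟨hvw', hvw⟩) hw.ne'
    rw [compl_adj] at this
    exact this.2 hw
  refine h.not_colorable ⟨Coloring.mk (fun w => if w = u then c v else c w) ?_⟩
  intro a b hab
  by_cases ha : a = u
  · subst ha
    simpa [hab.ne'] using key b hab
  · by_cases hb : b = u
    · subst hb
      simpa [ha] using (key a hab.symm).symm
    · simpa [ha, hb] using hc a b ha hb hab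

/-- Every vertex of a critical graph sees every colour class of the rest. -/
lemma IsColorCritical.compl_neighbors (h : G.IsColorCritical (k + 1)) (hk : 0 < k)
    (hcard : Fintype.card V = k + 4) {v : V} {s : Finset V} (hs : ∀ w ∈ s, Gᶜ.Adj v w) :
    s.card ≤ 3 := by
  classical
  obtain ⟨c, hc⟩ := h.exists_coloring_off_vertex hk v
  -- A colour not seen by `v` could be given to `v`.
  have hsurj : ∀ i : Fin k, ∃ w, G.Adj v w ∧ c w = i := by
    by_contra! hcon
    obtain ⟨i, hi⟩ := hcon
    refine h.not_colorable ⟨Coloring.mk (fun w => if w = v then i else c w) ?_⟩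
    intro a b hab
    by_cases ha : a = v
    · subst ha
      simpa [hab.ne'] using (hi b hab).symm
    · by_cases hb : b = v
      · subst hb
        simpa [ha] using hi a hab.symm
      · simpa [ha, hb] using hc a b ha hb hab
  have h1 : k ≤ (Finset.univ.filter (fun w => G.Adj v w)).card := by
    calc k = (Finset.univ : Finset (Fin k)).card := by simp
      _ ≤ ((Finset.univ.filter (fun w => G.Adj v w)).image c).card := by
          apply Finset.card_le_card
          intro i _
          obtain ⟨w, hw, rfl⟩ := hsurj i
          exact Finset.mem_image_of_mem _ (by simpa using hw)
      _ ≤ _ := Finset.card_image_le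
  have hdisj : Disjoint (insert v s) (Finset.univ.filter (fun w => G.Adj v w)) := by
    rw [Finset.disjoint_left]
    intro w hw hw'
    simp only [Finset.mem_filter, Finset.mem_univ, true_and] at hw'
    rcases Finset.mem_insert.mp hw with rfl | hw
    · exact hw'.ne rfl
    · have := hs w hw
      rw [compl_adj] at this
      exact this.2 hw'
  have hv : v ∉ s := fun hv => (hs v hv).ne rfl
  have h2 := Finset.card_le_univ (insert v s ∪ Finset.univ.filter (fun w => G.Adj v w))
  rw [Finset.card_union_of_disjoint hdisj, Finset.card_insert_of_notMem hv, hcard] at h2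
  omega

/-- Pairwise disjoint nonadjacent pairs can share colours. -/
lemma IsColorCritical.not_four_disjoint (h : G.IsColorCritical (k + 1))
    (hcard : Fintype.card V = k + 4) {a b c d a' b' c' d' : V}
    (hn : [a, b, c, d, a', b', c', d'].Nodup) (ha : Gᶜ.Adj a a') (hb : Gᶜ.Adj b b')
    (hc : Gᶜ.Adj c c') : ¬ Gᶜ.Adj d d' := by
  classical
  intro hd
  rw [compl_adj] at ha hb hc hd
  simp only [List.nodup_cons, List.mem_cons, List.not_mem_nil, not_or] at hn
  -- Using vertices as colours, each primed vertex takes the colour of its partner; `k + 4 - 4`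
  -- colours remain.
  let f : V → {v : V // v ∉ ({a', b', c', d'} : Finset V)} := fun v =>
    if ha' : v = a' then ⟨a, by simp; grind⟩
    else if hb' : v = b' then ⟨b, by simp; grind⟩
    else if hc' : v = c' then ⟨c, by simp; grind⟩
    else if hd' : v = d' then ⟨d, by simp; grind⟩
    else ⟨v, by simp [*]⟩
  have hf : ∀ v w, G.Adj v w → f v ≠ f w := by
    intro v w hvw heq
    have heq' := congrArg Subtype.val heq
    simp only [f] at heq'
    have hsymm := hvw.symm
    have hne := hvw.ne
    have s1 : ¬ G.Adj a' a := fun h => ha.2 h.symm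
    have s2 : ¬ G.Adj b' b := fun h => hb.2 h.symm
    have s3 : ¬ G.Adj c' c := fun h => hc.2 h.symm
    have s4 : ¬ G.Adj d' d := fun h => hd.2 h.symm
    grind
  have hcol : G.Colorable (Fintype.card {v : V // v ∉ ({a', b', c', d'} : Finset V)}) :=
    (Coloring.mk f (fun {v w} h => hf v w h)).colorable
  refine h.not_colorable (hcol.mono ?_)
  rw [Fintype.card_subtype_compl]
  have : Fintype.card {v : V // v ∈ ({a', b', c', d'} : Finset V)} = 4 := by
    rw [Fintype.card_coe]
    rw [Finset.card_insert_of_notMem, Finset.card_insert_of_notMem, Finset.card_insert_of_notMem,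
      Finset.card_singleton] <;> simp <;> grind
  omega

end Complement

/-! ### Vertices outside a matching of three edges -/

section Matching

variable {V : Type*}

/-- There are no four pairwise disjoint edges. -/
def NoFourDisjoint (H : SimpleGraph V) : Prop :=
  ∀ ⦃a a' b b' c c' d d' : V⦄, H.Adj a a' → H.Adj b b' → H.Adj c c' → H.Adj d d' →
    a = b ∨ a = b' ∨ a' = b ∨ a' = b' ∨ a = c ∨ a = c' ∨ a' = c ∨ a' = c' ∨
    a = d ∨ a = d' ∨ a' = d ∨ a' = d' ∨ b = c ∨ b = c' ∨ b' = c ∨ b' = c' ∨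
    b = d ∨ b = d' ∨ b' = d ∨ b' = d' ∨ c = d ∨ c = d' ∨ c' = d ∨ c' = d'

/-- No closed neighbourhood is contained in that of an adjacent vertex. -/
def NoNestedNeighbors (H : SimpleGraph V) : Prop :=
  ∀ ⦃u v : V⦄, H.Adj u v → ∃ w, H.Adj v w ∧ w ≠ u ∧ ¬ H.Adj u w

/-- All degrees are at most three. -/
def NoFourNeighbors (H : SimpleGraph V) : Prop :=
  ∀ ⦃v a b c d : V⦄, H.Adj v a → H.Adj v b → H.Adj v c → H.Adj v d →
    a = b ∨ a = c ∨ a = d ∨ b = c ∨ b = d ∨ c = d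

variable {H : SimpleGraph V}

lemma nodup_eight_iff {a b c d e f x y : V} : [a, b, c, d, e, f, x, y].Nodup ↔
    (a ≠ b ∧ a ≠ c ∧ a ≠ d ∧ a ≠ e ∧ a ≠ f ∧ a ≠ x ∧ a ≠ y) ∧
    (b ≠ c ∧ b ≠ d ∧ b ≠ e ∧ b ≠ f ∧ b ≠ x ∧ b ≠ y) ∧
    (c ≠ d ∧ c ≠ e ∧ c ≠ f ∧ c ≠ x ∧ c ≠ y) ∧ (d ≠ e ∧ d ≠ f ∧ d ≠ x ∧ d ≠ y) ∧
    (e ≠ f ∧ e ≠ x ∧ e ≠ y) ∧ (f ≠ x ∧ f ≠ y) ∧ x ≠ y := by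
  simp only [List.nodup_cons, List.mem_cons, List.not_mem_nil, not_or, or_false, not_false_eq_true,
    List.nodup_nil, and_true, ne_eq]

/-- No two vertices outside a matching of three edges are adjacent to the same ends of two of
its edges. -/
lemma NoFourDisjoint.false_of_two_common (h4 : H.NoFourDisjoint) (hn : H.NoNestedNeighbors)
    (hd : H.NoFourNeighbors) {a₁ b₁ a₂ b₂ a₃ b₃ x y : V}
    (hnd : [a₁, b₁, a₂, b₂, a₃, b₃, x, y].Nodup) (h₁ : H.Adj a₁ b₁) (h₂ : H.Adj a₂ b₂)
    (h₃ : H.Adj a₃ b₃) (x₁ : H.Adj x a₁) (x₂ : H.Adj x a₂) (y₁ : H.Adj y a₁)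
    (y₂ : H.Adj y a₂) : False := by
  rw [nodup_eight_iff] at hnd
  have full₁ : ∀ z, H.Adj a₁ z → z = b₁ ∨ z = x ∨ z = y := by
    intro z hz
    have := hd h₁ x₁.symm y₁.symm hz
    grind
  have full₂ : ∀ z, H.Adj a₂ z → z = b₂ ∨ z = x ∨ z = y := by
    intro z hz
    have := hd h₂ x₂.symm y₂.symm hz
    grind
  -- Any other `p` gives four disjoint edges: `x` or `y` takes over `a₁`, and for `p = b₂` the edges
  -- `x a₁`, `y a₂` free both `b₁` and `b₂`.
  have second₁ : ∀ p, H.Adj b₁ p → p ≠ a₁ → p = a₃ ∨ p = b₃ := by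
    intro p hp hpa
    have e₁ := full₂ b₁
    have e₂ := h4 hp x₁ h₂ h₃
    have e₃ := h4 hp y₁ h₂ h₃
    have e₄ := h4 hp x₁ y₂ h₃
    have e₅ := hp.ne
    have e₆ := hp.symm
    grind
  have second₂ : ∀ p, H.Adj b₂ p → p ≠ a₂ → p = a₃ ∨ p = b₃ := by
    intro p hp hpa
    have e₁ := full₁ b₂
    have e₂ := h4 hp x₂ h₁ h₃
    have e₃ := h4 hp y₂ h₁ h₃
    have e₄ := h4 hp x₂ y₁ h₃
    have e₅ := hp.ne
    have e₆ := hp.symm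
    grind
  -- The far end `b` of the third edge has a second neighbour `s`, not `a₁` or `a₂`, whose
  -- neighbours are known; every position of `s` yields four disjoint edges.
  have last : ∀ {a b : V}, (a = a₃ ∧ b = b₃) ∨ (a = b₃ ∧ b = a₃) → H.Adj a b → H.Adj b₁ a →
      H.Adj b₂ a → False := by
    intro a b hab hadj hb₁ hb₂
    obtain ⟨s, hs, hsa, -⟩ := hn hadj
    have e₁ := full₁ b
    have e₂ := full₂ b
    have e₃ := h4 hs hb₁ h₂ y₁
    have e₄ := h4 hs hb₁ h₂ x₁
    have e₅ := h4 hs hb₂ x₁ y₂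
    have e₆ := h4 hs hb₁ x₁ y₂
    have e₇ := hs.ne
    have e₈ := hs.symm
    rcases hab with ⟨rfl, rfl⟩ | ⟨rfl, rfl⟩ <;> grind
  obtain ⟨p, hp, hpa, -⟩ := hn h₁
  obtain ⟨q, hq, hqa, -⟩ := hn h₂
  have := second₁ p hp hpa
  have := second₂ q hq hqa
  have hpq : p = q := by
    have := h4 hp hq x₁ y₂
    grind
  subst hpq
  rcases second₁ p hp hpa with rfl | rfl
  · exact last (Or.inl ⟨rfl, rfl⟩) h₃ hp hq
  · exact last (Or.inr ⟨rfl, rfl⟩) h₃.symm hp hq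

/-- No two vertices outside a matching of three edges have a common neighbour. -/
lemma NoFourDisjoint.false_of_common (h4 : H.NoFourDisjoint) (hn : H.NoNestedNeighbors)
    (hd : H.NoFourNeighbors) {a₁ b₁ a₂ b₂ a₃ b₃ x y : V}
    (hnd : [a₁, b₁, a₂, b₂, a₃, b₃, x, y].Nodup) (h₁ : H.Adj a₁ b₁) (h₂ : H.Adj a₂ b₂)
    (h₃ : H.Adj a₃ b₃) (x₁ : H.Adj x a₁) (y₁ : H.Adj y a₁) : False := by
  rw [nodup_eight_iff] at hnd
  -- When `x` and `y` attach to different edges, a second neighbour of `b₁` must be `c` or `c'`.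
  -- Exchanging `a₁ b₁` for `a₁ y` or `a₁ x` puts `b₁` outside the matching, with two neighbours in
  -- common with `x` or `y`.
  have main : ∀ {c d c' d' : V}, [a₁, b₁, c, d, c', d', x, y].Nodup → H.Adj c d →
      H.Adj c' d' → H.Adj x c → H.Adj y c' → False := by
    intro c d c' d' hnd hc hc' hx hy
    rw [nodup_eight_iff] at hnd
    obtain ⟨s, hs, hsa, -⟩ := hn h₁
    have hsc : s = c ∨ s = c' := by
      have e₁ := h4 hs x₁ hc hc'
      have e₂ := h4 hs y₁ hc hc'
      have e₃ := h4 hs y₁ hx hc'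
      have e₄ := h4 hs x₁ hy hc
      have e₅ := hs.ne
      grind
    rcases hsc with rfl | rfl
    · exact h4.false_of_two_common hn hd (a₁ := a₁) (b₁ := y) (a₂ := s) (b₂ := d) (a₃ := c')
        (b₃ := d') (x := x) (y := b₁)
        (by simp only [nodup_eight_iff] at *; grind) y₁.symm hc hc' x₁ hx h₁.symm hs
    · exact h4.false_of_two_common hn hd (a₁ := a₁) (b₁ := x) (a₂ := s) (b₂ := d') (a₃ := c)
        (b₃ := d) (x := y) (y := b₁)
        (by simp only [nodup_eight_iff] at *; grind) x₁.symm hc' hc y₁ hy h₁.symm hs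
  obtain ⟨p, hp, hpa, -⟩ := hn x₁.symm
  obtain ⟨q, hq, hqa, -⟩ := hn y₁.symm
  have hp' : p = a₂ ∨ p = b₂ ∨ p = a₃ ∨ p = b₃ := by
    have e₁ := h4 hp h₁ h₂ h₃
    have e₂ := h4 hp y₁ h₂ h₃
    have e₅ := hp.ne
    grind
  have hq' : q = a₂ ∨ q = b₂ ∨ q = a₃ ∨ q = b₃ := by
    have e₁ := h4 hq h₁ h₂ h₃
    have e₂ := h4 hq x₁ h₂ h₃
    have e₅ := hq.ne
    grind
  have e₁ := h4 hp hq h₁ h₂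
  have e₂ := h4 hp hq h₁ h₃
  by_cases hpq : p = q
  · subst hpq
    rcases hp' with rfl | rfl | rfl | rfl
    · exact h4.false_of_two_common hn hd
        (by simp only [nodup_eight_iff] at *; grind) h₁ h₂ h₃ x₁ hp y₁ hq
    · exact h4.false_of_two_common hn hd
        (by simp only [nodup_eight_iff] at *; grind) h₁ h₂.symm h₃ x₁ hp y₁ hq
    · exact h4.false_of_two_common hn hd
        (by simp only [nodup_eight_iff] at *; grind) h₁ h₃ h₂ x₁ hp y₁ hq
    · exact h4.false_of_two_common hn hd
        (by simp only [nodup_eight_iff] at *; grind) h₁ h₃.symm h₂ x₁ hp y₁ hq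
  · rcases hp' with rfl | rfl | rfl | rfl <;> rcases hq' with rfl | rfl | rfl | rfl <;>
      first
      | exact main (by simp only [nodup_eight_iff] at *; grind) h₂ h₃ hp hq
      | exact main (by simp only [nodup_eight_iff] at *; grind) h₂.symm h₃ hp hq
      | exact main (by simp only [nodup_eight_iff] at *; grind) h₂ h₃.symm hp hq
      | exact main (by simp only [nodup_eight_iff] at *; grind) h₂.symm h₃.symm hp hq
      | exact main (by simp only [nodup_eight_iff] at *; grind) h₃ h₂ hp hq
      | exact main (by simp only [nodup_eight_iff] at *; grind) h₃.symm h₂ hp hq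
      | exact main (by simp only [nodup_eight_iff] at *; grind) h₃ h₂.symm hp hq
      | exact main (by simp only [nodup_eight_iff] at *; grind) h₃.symm h₂.symm hp hq
      | grind

/-- If a vertex outside a matching of three edges is adjacent to both ends of one of them, then
every other vertex outside is isolated. -/
lemma NoFourDisjoint.false_of_triangle (h4 : H.NoFourDisjoint) (hn : H.NoNestedNeighbors)
    {a₁ b₁ a₂ b₂ a₃ b₃ x y z : V}
    (hnd : [a₁, b₁, a₂, b₂, a₃, b₃, x, y].Nodup) (h₁ : H.Adj a₁ b₁) (h₂ : H.Adj a₂ b₂)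
    (h₃ : H.Adj a₃ b₃) (x₁ : H.Adj x a₁) (x₂ : H.Adj x b₁) (hy : H.Adj z y) : False := by
  rw [nodup_eight_iff] at hnd
  have hyn : ∀ q, H.Adj y q → q = a₂ ∨ q = b₂ ∨ q = a₃ ∨ q = b₃ := by
    intro q hq
    have e₁ := h4 hq h₁ h₂ h₃
    have e₂ := h4 hq x₁ h₂ h₃
    have e₃ := h4 hq x₂ h₂ h₃
    have e₅ := hq.ne
    grind
  -- Here `t a b` is the triangle, attached to both ends of `p p'` and to `q`. Any neighbour of `y`
  -- except `q` gives four disjoint edges, so `y` has degree one and its neighbourhood is nested.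
  have main : ∀ {t a b p p' q q' : V}, [t, a, b, p, p', q, q', y].Nodup → H.Adj p p' →
      H.Adj q q' → H.Adj t a → H.Adj t b → H.Adj a b → H.Adj t p → H.Adj a p' → H.Adj b q →
      (∀ s, H.Adj y s → s = p ∨ s = p' ∨ s = q ∨ s = q') → False := by
    intro t a b p p' q q' hnd hp hq hta htb hab htp hap hbq hs
    rw [nodup_eight_iff] at hnd
    have only : ∀ s, H.Adj y s → s = q := by
      intro s hys
      have e₁ := h4 hys hap htb hq
      have e₂ := h4 hys htp hab hq
      have e₃ := h4 hys htp hap hbq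
      have := hs s hys
      grind
    obtain rfl := only z hy.symm
    obtain ⟨s, hys, hsz, -⟩ := hn hy
    exact hsz (only s hys)
  -- The witnesses are chosen cyclically, each not adjacent to the next triangle vertex, which makes
  -- them distinct. Being three among the four ends of two edges, they include both ends of one
  -- edge.
  obtain ⟨d, hxd, hda, hda'⟩ := hn x₁.symm
  obtain ⟨e, hae, heb, heb'⟩ := hn h₁.symm
  obtain ⟨f, hbf, hfx, hfx'⟩ := hn x₂
  have hd' : d = a₂ ∨ d = b₂ ∨ d = a₃ ∨ d = b₃ := by
    have e₁ := h4 hxd h₁ h₂ h₃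
    have e₂ := hyn x
    have e₅ := hxd.ne
    have e₆ := hxd.symm
    grind
  have he' : e = a₂ ∨ e = b₂ ∨ e = a₃ ∨ e = b₃ := by
    have e₁ := h4 hae x₂ h₂ h₃
    have e₂ := hyn a₁
    have e₅ := hae.ne
    have e₆ := hae.symm
    have e₇ := x₂.symm
    grind
  have hf' : f = a₂ ∨ f = b₂ ∨ f = a₃ ∨ f = b₃ := by
    have e₁ := h4 hbf x₁ h₂ h₃
    have e₂ := hyn b₁
    have e₅ := hbf.ne
    have e₆ := hbf.symm
    grind
  have hde : d ≠ e := by grind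
  have hdf : d ≠ f := by grind
  have hef : e ≠ f := by grind
  have step : ∀ {p p' q q' : V}, [a₁, b₁, p, p', q, q', x, y].Nodup → H.Adj p p' →
      H.Adj q q' → (∀ s, H.Adj y s → s = p ∨ s = p' ∨ s = q ∨ s = q') →
      (d = p ∧ e = p' ∧ f = q) ∨ (d = p ∧ f = p' ∧ e = q) ∨ (e = p ∧ f = p' ∧ d = q) →
      False := by
    intro p p' q q' hnd hp hq hs hcases
    rcases hcases with ⟨rfl, rfl, rfl⟩ | ⟨rfl, rfl, rfl⟩ | ⟨rfl, rfl, rfl⟩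
    · exact main (by simp only [nodup_eight_iff] at *; grind) hp hq x₁ x₂ h₁ hxd hae hbf hs
    · exact main (by simp only [nodup_eight_iff] at *; grind) hp hq x₂ x₁ h₁.symm hxd hbf hae hs
    · exact main
        (by simp only [nodup_eight_iff] at *; grind) hp hq h₁ x₁.symm x₂.symm hae hbf hxd hs
  have s₁ := step
    (by simp only [nodup_eight_iff] at *; grind) h₂ h₃
    (by simp only [nodup_eight_iff] at *; grind)
  have s₂ := step
    (by simp only [nodup_eight_iff] at *; grind) h₂.symm h₃
    (by simp only [nodup_eight_iff] at *; grind)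
  have s₃ := step
    (by simp only [nodup_eight_iff] at *; grind) h₂ h₃.symm
    (by simp only [nodup_eight_iff] at *; grind)
  have s₄ := step
    (by simp only [nodup_eight_iff] at *; grind) h₂.symm h₃.symm
    (by simp only [nodup_eight_iff] at *; grind)
  have s₅ := step
    (by simp only [nodup_eight_iff] at *; grind) h₃ h₂
    (by simp only [nodup_eight_iff] at *; grind)
  have s₆ := step
    (by simp only [nodup_eight_iff] at *; grind) h₃.symm h₂
    (by simp only [nodup_eight_iff] at *; grind)
  have s₇ := step
    (by simp only [nodup_eight_iff] at *; grind) h₃ h₂.symm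
    (by simp only [nodup_eight_iff] at *; grind)
  have s₈ := step
    (by simp only [nodup_eight_iff] at *; grind) h₃.symm h₂.symm
    (by simp only [nodup_eight_iff] at *; grind)
  clear step main hyn h4 hn
  grind (splits := 40)

/-- At most one nonisolated vertex lies outside a matching of three edges. -/
lemma NoFourDisjoint.false_of_matching (h4 : H.NoFourDisjoint) (hn : H.NoNestedNeighbors)
    (hd : H.NoFourNeighbors) {a₁ b₁ a₂ b₂ a₃ b₃ x y x' y' : V}
    (hnd : [a₁, b₁, a₂, b₂, a₃, b₃, x, y].Nodup) (h₁ : H.Adj a₁ b₁) (h₂ : H.Adj a₂ b₂)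
    (h₃ : H.Adj a₃ b₃) (hx : H.Adj x' x) (hy : H.Adj y' y) : False := by
  have hnd' := hnd
  rw [nodup_eight_iff] at hnd
  have inside : ∀ {s t}, s = x ∨ s = y → H.Adj s t → t ≠ x → t ≠ y →
      (t = a₁ ∨ t = b₁) ∨ (t = a₂ ∨ t = b₂) ∨ (t = a₃ ∨ t = b₃) := by
    intro s t hs hst hx hy
    have e₁ := h4 hst h₁ h₂ h₃
    have e₂ := hst.ne
    grind
  have hxy : ¬ H.Adj x y := by
    intro hxy
    have := h4 hxy h₁ h₂ h₃
    grind
  have hyx : ¬ H.Adj y x := fun h => hxy h.symm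
  have common : ∀ t, H.Adj x t → H.Adj y t → False := by
    intro t hxt hyt
    rcases inside (Or.inl rfl) hxt hxt.ne' (by rintro rfl; exact hxy hxt) with
      (rfl | rfl) | (rfl | rfl) | (rfl | rfl)
    · exact h4.false_of_common hn hd hnd' h₁ h₂ h₃ hxt hyt
    · exact h4.false_of_common hn hd
        (by simp only [nodup_eight_iff] at *; grind) h₁.symm h₂ h₃ hxt hyt
    · exact h4.false_of_common hn hd (by simp only [nodup_eight_iff] at *; grind) h₂ h₁ h₃ hxt hyt
    · exact h4.false_of_common hn hd
        (by simp only [nodup_eight_iff] at *; grind) h₂.symm h₁ h₃ hxt hyt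
    · exact h4.false_of_common hn hd (by simp only [nodup_eight_iff] at *; grind) h₃ h₁ h₂ hxt hyt
    · exact h4.false_of_common hn hd
        (by simp only [nodup_eight_iff] at *; grind) h₃.symm h₁ h₂ hxt hyt
  have tri : ∀ {s t s'}, (s = x ∧ t = y) ∨ (s = y ∧ t = x) → H.Adj s' t →
      ¬ (H.Adj s a₁ ∧ H.Adj s b₁) ∧ ¬ (H.Adj s a₂ ∧ H.Adj s b₂) ∧
      ¬ (H.Adj s a₃ ∧ H.Adj s b₃) := by
    intro s t s' hst ht
    have hnd₁ : [a₁, b₁, a₂, b₂, a₃, b₃, s, t].Nodup := by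
      rw [nodup_eight_iff]
      rcases hst with ⟨rfl, rfl⟩ | ⟨rfl, rfl⟩ <;> grind
    clear hst
    refine ⟨fun h => ?_, fun h => ?_, fun h => ?_⟩
    · exact h4.false_of_triangle hn (y := t)
        (by simp only [nodup_eight_iff] at *; grind) h₁ h₂ h₃ h.1 h.2 ht
    · exact h4.false_of_triangle hn (y := t)
        (by simp only [nodup_eight_iff] at *; grind) h₂ h₁ h₃ h.1 h.2 ht
    · exact h4.false_of_triangle hn (y := t)
        (by simp only [nodup_eight_iff] at *; grind) h₃ h₁ h₂ h.1 h.2 ht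
  have tx := tri (Or.inl ⟨rfl, rfl⟩) hy
  have ty := tri (Or.inr ⟨rfl, rfl⟩) hx
  have two : ∀ {s s'}, s = x ∨ s = y → H.Adj s' s →
      ¬ (H.Adj s a₁ ∧ H.Adj s b₁) ∧ ¬ (H.Adj s a₂ ∧ H.Adj s b₂) ∧ ¬ (H.Adj s a₃ ∧ H.Adj s b₃) →
      (H.Adj s a₁ ∨ H.Adj s b₁) ∧ (H.Adj s a₂ ∨ H.Adj s b₂) ∨
      (H.Adj s a₁ ∨ H.Adj s b₁) ∧ (H.Adj s a₃ ∨ H.Adj s b₃) ∨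
      (H.Adj s a₂ ∨ H.Adj s b₂) ∧ (H.Adj s a₃ ∨ H.Adj s b₃) := by
    intro s s' hs hss' ht
    obtain ⟨p, hp, hps, -⟩ := hn hss'
    have hss := hss'.symm
    have n₁ : ∀ t, H.Adj s t → t ≠ x ∧ t ≠ y := by
      intro t hst
      have := hst.ne
      rcases hs with rfl | rfl
      · exact ⟨this.symm, by rintro rfl; exact hxy hst⟩
      · exact ⟨by rintro rfl; exact hyx hst, this.symm⟩
    have pick : ∀ {a b t}, t = a ∨ t = b → H.Adj s t → H.Adj s a ∨ H.Adj s b := by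
      rintro a b t (rfl | rfl) h
      exacts [Or.inl h, Or.inr h]
    have same : ∀ {a b}, s' = a ∨ s' = b → p = a ∨ p = b → H.Adj s a ∧ H.Adj s b := by
      rintro a b (rfl | rfl) (rfl | rfl)
      exacts [absurd rfl hps, ⟨hss, hp⟩, ⟨hp, hss⟩, absurd rfl hps]
    rcases inside hs hss (n₁ _ hss).1 (n₁ _ hss).2 with h | h | h <;>
      rcases inside hs hp (n₁ _ hp).1 (n₁ _ hp).2 with h' | h' | h'
    · exact absurd (same h h') ht.1
    · exact Or.inl ⟨pick h hss, pick h' hp⟩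
    · exact Or.inr (Or.inl ⟨pick h hss, pick h' hp⟩)
    · exact Or.inl ⟨pick h' hp, pick h hss⟩
    · exact absurd (same h h') ht.2.1
    · exact Or.inr (Or.inr ⟨pick h hss, pick h' hp⟩)
    · exact Or.inr (Or.inl ⟨pick h' hp, pick h hss⟩)
    · exact Or.inr (Or.inr ⟨pick h' hp, pick h hss⟩)
    · exact absurd (same h h') ht.2.2
  have cross : ∀ {a b}, (∀ {s t}, (s = a ∧ t = b) ∨ (s = b ∧ t = a) → H.Adj x s → H.Adj y t →
      False) → ¬ ((H.Adj x a ∨ H.Adj x b) ∧ (H.Adj y a ∨ H.Adj y b)) := by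
    rintro a b h ⟨hx | hx, hy | hy⟩
    · exact common _ hx hy
    · exact h (Or.inl ⟨rfl, rfl⟩) hx hy
    · exact h (Or.inr ⟨rfl, rfl⟩) hx hy
    · exact common _ hx hy
  have c₁ := cross (a := a₁) (b := b₁) (by
    intro s t hst hs ht
    have := h4 hs ht h₂ h₃
    rcases hst with ⟨rfl, rfl⟩ | ⟨rfl, rfl⟩ <;> grind)
  have c₂ := cross (a := a₂) (b := b₂) (by
    intro s t hst hs ht
    have := h4 hs ht h₁ h₃
    rcases hst with ⟨rfl, rfl⟩ | ⟨rfl, rfl⟩ <;> grind)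
  have c₃ := cross (a := a₃) (b := b₃) (by
    intro s t hst hs ht
    have := h4 hs ht h₁ h₂
    rcases hst with ⟨rfl, rfl⟩ | ⟨rfl, rfl⟩ <;> grind)
  have two_x := two (Or.inl rfl) hx tx
  have two_y := two (Or.inr rfl) hy ty
  -- Each of `x` and `y` meets two of the three edges, so some edge meets both; sharing an end and
  -- using opposite ends are both excluded.
  rcases two_x with h | h | h <;> rcases two_y with h' | h' | h' <;>
    first
    | exact c₁ ⟨h.1, h'.1⟩
    | exact c₂ ⟨h.2, h'.2⟩
    | exact c₂ ⟨h.2, h'.1⟩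
    | exact c₂ ⟨h.1, h'.2⟩
    | exact c₂ ⟨h.1, h'.1⟩
    | exact c₃ ⟨h.2, h'.2⟩

end Matching

/-! ### The bound of seven nonisolated vertices -/

section Matching

variable {V : Type*} {H : SimpleGraph V}

/-- A graph without nested neighbourhoods, of maximum degree three, without four disjoint edges
has at most seven nonisolated vertices. -/
lemma NoFourDisjoint.card_le (h4 : H.NoFourDisjoint) (hn : H.NoNestedNeighbors)
    (hd : H.NoFourNeighbors) {s : Finset V} (hs : ∀ x ∈ s, ∃ y, H.Adj x y) : s.card ≤ 7 := by
  classical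
  by_contra! hcard
  -- There are eight vertices to choose from, and non-nesting gives each a second neighbour.
  have fresh : ∀ l : List V, l.length ≤ 7 →
      ∃ x, x ∉ l ∧ ∃ y z, H.Adj x y ∧ H.Adj x z ∧ y ≠ z := by
    intro l hl
    obtain ⟨x, hx, hxl⟩ := Finset.exists_mem_notMem_of_card_lt_card
      (lt_of_le_of_lt (l.toFinset_card_le.trans hl) hcard)
    obtain ⟨y, hy⟩ := hs x hx
    obtain ⟨z, hz, hzy, -⟩ := hn hy.symm
    exact ⟨x, by simpa using hxl, y, z, hy, hz, hzy.symm⟩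
  obtain ⟨a, b, c, d, hab, hcd, hca, hcb, hda, hdb⟩ :
      ∃ a b c d, H.Adj a b ∧ H.Adj c d ∧ c ≠ a ∧ c ≠ b ∧ d ≠ a ∧ d ≠ b := by
    by_contra hcon'
    have hcon : ∀ a b c d, H.Adj a b → H.Adj c d → c = a ∨ c = b ∨ d = a ∨ d = b := by
      intro a b c d h h'
      by_contra! hne
      exact hcon' ⟨a, b, c, d, h, h', hne⟩
    obtain ⟨a, -, b, -, hab, -, -⟩ := fresh [] (by simp)
    obtain ⟨x, hx, x', x'', hx', hx'', hxx⟩ := fresh [a, b] (by simp)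
    obtain ⟨y, hy, y', y'', hy', hy'', hyy⟩ := fresh [a, b, x] (by simp)
    simp only [List.mem_cons, not_or, List.not_mem_nil] at hx hy
    have e₁ := hcon _ _ _ _ hab hx'
    have e₂ := hcon _ _ _ _ hab hx''
    have e₃ := hcon _ _ _ _ hab hy'
    have e₄ := hcon _ _ _ _ hx' hy'
    have e₅ := hcon _ _ _ _ hx'' hy'
    grind
  obtain ⟨a₁, b₁, a₂, b₂, a₃, b₃, h₁, h₂, h₃, hne⟩ :
      ∃ a₁ b₁ a₂ b₂ a₃ b₃, H.Adj a₁ b₁ ∧ H.Adj a₂ b₂ ∧ H.Adj a₃ b₃ ∧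
        a₁ ≠ a₂ ∧ a₁ ≠ b₂ ∧ b₁ ≠ a₂ ∧ b₁ ≠ b₂ ∧ a₁ ≠ a₃ ∧ a₁ ≠ b₃ ∧ b₁ ≠ a₃ ∧ b₁ ≠ b₃ ∧
        a₂ ≠ a₃ ∧ a₂ ≠ b₃ ∧ b₂ ≠ a₃ ∧ b₂ ≠ b₃ := by
    by_contra hcon'
    have hcon : ∀ a₁ b₁ a₂ b₂ a₃ b₃, H.Adj a₁ b₁ → H.Adj a₂ b₂ → H.Adj a₃ b₃ →
        a₁ = a₂ ∨ a₁ = b₂ ∨ b₁ = a₂ ∨ b₁ = b₂ ∨ a₁ = a₃ ∨ a₁ = b₃ ∨ b₁ = a₃ ∨ b₁ = b₃ ∨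
        a₂ = a₃ ∨ a₂ = b₃ ∨ b₂ = a₃ ∨ b₂ = b₃ := by
      intro a₁ b₁ a₂ b₂ a₃ b₃ h h' h''
      by_contra! hne
      exact hcon' ⟨a₁, b₁, a₂, b₂, a₃, b₃, h, h', h'', hne⟩
    -- An augmenting path: `x a` and `y b` would replace `a b`.
    have aug : ∀ {a b c d x y}, H.Adj a b → H.Adj c d → c ≠ a → c ≠ b → d ≠ a → d ≠ b →
        x ≠ y → x ≠ a → x ≠ b → x ≠ c → x ≠ d → y ≠ a → y ≠ b → y ≠ c → y ≠ d →
        H.Adj x a → ¬ H.Adj y b := by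
      intro a b c d x y hab hcd _ _ _ _ _ _ _ _ _ _ _ _ _ hx hy
      have := hcon _ _ _ _ _ _ hx hy hcd
      have := hab.ne
      grind
    have two : ∀ {x y z}, x ≠ a → x ≠ b → x ≠ c → x ≠ d → H.Adj x y → H.Adj x z → y ≠ z →
        (H.Adj x a ∧ H.Adj x b) ∨ (H.Adj x c ∧ H.Adj x d) ∨
        ((H.Adj x a ∨ H.Adj x b) ∧ (H.Adj x c ∨ H.Adj x d)) := by
      intro x y z _ _ _ _ hy hz hyz
      have e₁ := hcon _ _ _ _ _ _ hab hcd hy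
      have e₂ := hcon _ _ _ _ _ _ hab hcd hz
      grind
    obtain ⟨x, hx, x', x'', hx', hx'', hxx⟩ := fresh [a, b, c, d] (by simp)
    obtain ⟨y, hy, y', y'', hy', hy'', hyy⟩ := fresh [a, b, c, d, x] (by simp)
    obtain ⟨z, hz, z', z'', hz', hz'', hzz⟩ := fresh [a, b, c, d, x, y] (by simp)
    simp only [List.mem_cons, not_or, List.not_mem_nil] at hx hy hz
    obtain ⟨hxa, hxb, hxc, hxd, -⟩ := hx
    obtain ⟨hya, hyb, hyc, hyd, hyx, -⟩ := hy
    obtain ⟨hza, hzb, hzc, hzd, hzx, hzy, -⟩ := hz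
    -- If one of `x`, `y`, `z` sees both ends of an edge, the other two must both see both ends of
    -- the other edge, against `aug`. Otherwise all three see the same end of `a b`, which then has
    -- degree four.
    have tx := two hxa hxb hxc hxd hx' hx'' hxx
    have ty := two hya hyb hyc hyd hy' hy'' hyy
    have tz := two hza hzb hzc hzd hz' hz'' hzz
    have aug' : ∀ {u v}, u ≠ v → (u = x ∨ u = y ∨ u = z) → (v = x ∨ v = y ∨ v = z) →
        (H.Adj u a → ¬ H.Adj v b) ∧ (H.Adj u c → ¬ H.Adj v d) := by
      intro u v huv hu hv
      have hu' : u ≠ a ∧ u ≠ b ∧ u ≠ c ∧ u ≠ d := by grind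
      have hv' : v ≠ a ∧ v ≠ b ∧ v ≠ c ∧ v ≠ d := by grind
      exact ⟨aug hab hcd hca hcb hda hdb huv hu'.1 hu'.2.1 hu'.2.2.1 hu'.2.2.2 hv'.1 hv'.2.1
        hv'.2.2.1 hv'.2.2.2, aug hcd hab hca.symm hda.symm hcb.symm hdb.symm huv hu'.2.2.1
        hu'.2.2.2 hu'.1 hu'.2.1 hv'.2.2.1 hv'.2.2.2 hv'.1 hv'.2.1⟩
    have g₁ := aug' (Ne.symm hyx) (by simp) (by simp)
    have g₂ := aug' hyx (by simp) (by simp)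
    have g₃ := aug' (Ne.symm hzx) (by simp) (by simp)
    have g₄ := aug' hzx (by simp) (by simp)
    have g₅ := aug' (Ne.symm hzy) (by simp) (by simp)
    have g₆ := aug' hzy (by simp) (by simp)
    have da : ¬ (H.Adj x a ∧ H.Adj y a ∧ H.Adj z a) := by
      rintro ⟨p, q, r⟩
      have := hd p.symm q.symm r.symm hab
      grind
    have db : ¬ (H.Adj x b ∧ H.Adj y b ∧ H.Adj z b) := by
      rintro ⟨p, q, r⟩
      have := hd p.symm q.symm r.symm hab.symm
      grind
    clear aug aug' two hcon hd hn h4 fresh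
    grind (splits := 30)
  obtain ⟨x, hx, x', -, hx', -⟩ := fresh [a₁, b₁, a₂, b₂, a₃, b₃] (by simp)
  obtain ⟨y, hy, y', -, hy', -⟩ := fresh [a₁, b₁, a₂, b₂, a₃, b₃, x] (by simp)
  simp only [List.mem_cons, not_or, List.not_mem_nil] at hx hy
  refine h4.false_of_matching hn hd (nodup_eight_iff.mpr ?_) h₁ h₂ h₃ hx'.symm hy'.symm
  have := h₁.ne
  have := h₂.ne
  have := h₃.ne
  grind

end Matching

/-! ### Nonuniversal vertices of a critical graph -/

section Complement

variable {V : Type*} [Fintype V] {G : SimpleGraph V} {k : ℕ}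

/-- A critical graph with three more vertices than colours has at most seven vertices that are
not adjacent to all others. -/
lemma IsColorCritical.card_nonuniversal_le (h : G.IsColorCritical (k + 1)) (hk : 0 < k)
    (hcard : Fintype.card V = k + 4) {s : Finset V} (hs : ∀ x ∈ s, ∃ y, Gᶜ.Adj x y) :
    s.card ≤ 7 := by
  classical
  refine NoFourDisjoint.card_le (H := Gᶜ) ?_ ?_ ?_ hs
  · intro a a' b b' c c' d d' ha hb hc hd
    by_contra hcon
    refine h.not_four_disjoint hcard (nodup_eight_iff.mpr ?_) ha hb hc hd
    have := ha.ne
    have := hb.ne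
    have := hc.ne
    have := hd.ne
    grind
  · intro u v huv
    exact h.exists_compl_adj hk huv
  · intro v a b c d ha hb hc hd
    by_contra hcon
    have := h.compl_neighbors hk hcard (v := v) (s := {a, b, c, d}) (by
      simp only [Finset.mem_insert, Finset.mem_singleton, forall_eq_or_imp, forall_eq]
      exact ⟨ha, hb, hc, hd⟩)
    rw [Finset.card_insert_of_notMem (by simp; grind), Finset.card_insert_of_notMem
      (by simp; grind), Finset.card_insert_of_notMem (by simp; grind), Finset.card_singleton]
      at this
    omega

end Complement

/-! ### Joins with complete graphs -/

section Join

variable {V W : Type*} {G : SimpleGraph V} {F : SimpleGraph W} {m k : ℕ}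

@[simp] lemma addSimplicial_inl_inl {a b : V} :
    (G.addSimplicial k).Adj (Sum.inl a) (Sum.inl b) ↔ G.Adj a b := by
  simp [addSimplicial, joinGraph]

@[simp] lemma addSimplicial_inl_inr {a : V} {i : Fin k} :
    (G.addSimplicial k).Adj (Sum.inl a) (Sum.inr i) := by
  simp [addSimplicial, joinGraph]

@[simp] lemma addSimplicial_inr_inl {a : V} {i : Fin k} :
    (G.addSimplicial k).Adj (Sum.inr i) (Sum.inl a) := by
  simp [addSimplicial, joinGraph]

@[simp] lemma addSimplicial_inr_inr {i j : Fin k} :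
    (G.addSimplicial k).Adj (Sum.inr i) (Sum.inr j) ↔ i ≠ j := by
  simp [addSimplicial, joinGraph, completeGraph]

lemma colorable_of_card_le {α : Type*} [Fintype α] (c : V → α)
    (hc : ∀ x y, G.Adj x y → c x ≠ c y) (hα : Fintype.card α ≤ m) : G.Colorable m :=
  (Coloring.mk c (fun {x y} h => hc x y h)).colorable.mono hα

lemma Colorable.addSimplicial (h : G.Colorable m) : (G.addSimplicial k).Colorable (m + k) := by
  obtain ⟨c⟩ := h
  refine colorable_of_card_le (α := Fin m ⊕ Fin k) (Sum.map c id) ?_ (by simp)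
  rintro (x | x) (y | y) h <;> simp at h ⊢
  · exact c.valid h
  · exact h

/-- The simplicial vertices use `k` distinct colours, none of which occurs on `G`. -/
lemma Colorable.of_addSimplicial (h : (G.addSimplicial k).Colorable (m + k)) :
    G.Colorable m := by
  classical
  obtain ⟨c⟩ := h
  let s : Finset (Fin (m + k)) := Finset.univ.image (fun i : Fin k => c (Sum.inr i))
  have hs : s.card = k := by
    rw [Finset.card_image_of_injective _ ?_]
    · simp
    · intro i j hij
      by_contra hne
      exact c.valid (addSimplicial_inr_inr.mpr hne) hij
  refine colorable_of_card_le (α := {x // x ∉ s})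
    (fun v => ⟨c (Sum.inl v), ?_⟩) ?_ ?_
  · simp only [s, Finset.mem_image, Finset.mem_univ, true_and, not_exists]
    exact fun i => c.valid addSimplicial_inr_inl
  · intro x y hxy heq
    exact c.valid (addSimplicial_inl_inl.mpr hxy) (congrArg Subtype.val heq)
  · rw [Fintype.card_subtype_compl, Fintype.card_coe, hs]
    simp

/-- A graph without isolated vertices that needs `m + 1` colours, but only `m` after the
deletion of any edge. -/
def IsEdgeCritical (F : SimpleGraph W) (m : ℕ) : Prop :=
  F.Colorable (m + 1) ∧ ¬ F.Colorable m ∧ (∀ v, ∃ w, F.Adj v w) ∧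
    ∀ a b, F.Adj a b → (F.deleteEdges {s(a, b)}).Colorable m

lemma colorable_deleteEdges {α : Type*} [Fintype α] {a b : V} (c : V → α)
    (hα : Fintype.card α ≤ m)
    (hc : ∀ x y, G.Adj x y → c x = c y → (x = a ∧ y = b) ∨ (x = b ∧ y = a)) :
    (G.deleteEdges {s(a, b)}).Colorable m := by
  refine colorable_of_card_le c ?_ hα
  intro x y hxy heq
  rw [deleteEdges_adj] at hxy
  exact hxy.2 (by simpa [Sym2.eq_iff] using hc x y hxy.1 heq)

lemma IsEdgeCritical.exists_off_vertex (h : F.IsEdgeCritical m) (v : W) :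
    ∃ c : W → Fin m, ∀ a b, a ≠ v → b ≠ v → F.Adj a b → c a ≠ c b := by
  obtain ⟨w, hw⟩ := h.2.2.1 v
  obtain ⟨c⟩ := h.2.2.2 v w hw
  refine ⟨c, fun a b ha hb hab => c.valid ?_⟩
  rw [deleteEdges_adj]
  refine ⟨hab, ?_⟩
  simp only [Set.mem_singleton_iff, Sym2.eq_iff]
  tauto

/-- The deleted edge may lie in `F`, in the complete graph, or between them; in the last two cases
its ends are given the same colour. -/
lemma IsEdgeCritical.addSimplicial [Nonempty W] (h : F.IsEdgeCritical m) (k : ℕ) :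
    (F.addSimplicial k).IsEdgeCritical (m + k) := by
  classical
  -- `F` without `a` needs only `m` colours, and `a` takes the colour of the new vertex `i`.
  have hoff : ∀ (a : W) (i : Fin k),
      ((F.addSimplicial k).deleteEdges {s(Sum.inl a, Sum.inr i)}).Colorable (m + k) := by
    intro a i
    obtain ⟨c, hc⟩ := h.exists_off_vertex a
    refine colorable_deleteEdges (α := Fin m ⊕ Fin k)
      (Sum.elim (fun v => if v = a then Sum.inr i else Sum.inl (c v)) Sum.inr) (by simp) ?_
    rintro (x | x) (y | y) hxy heq
    · exfalso
      simp only [addSimplicial_inl_inl] at hxy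
      simp only [Sum.elim_inl] at heq
      have := hc x y
      have := hxy.ne
      grind
    · simp only [Sum.elim_inl, Sum.elim_inr] at heq
      grind
    · simp only [Sum.elim_inl, Sum.elim_inr] at heq
      grind
    · simp_all
  refine ⟨?_, fun hc => h.2.1 hc.of_addSimplicial, ?_, ?_⟩
  · rw [show m + k + 1 = m + 1 + k by omega]
    exact h.1.addSimplicial
  · rintro (v | i)
    · obtain ⟨w, hw⟩ := h.2.2.1 v
      exact ⟨Sum.inl w, by simpa using hw⟩
    · exact ⟨Sum.inl (Classical.arbitrary W), by simp⟩
  · rintro (a | i) (b | j) hab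
    · obtain ⟨c⟩ := h.2.2.2 a b (by simpa using hab)
      refine colorable_deleteEdges (α := Fin m ⊕ Fin k) (Sum.map c id) (by simp) ?_
      rintro (x | x) (y | y) hxy heq
      · simp only [addSimplicial_inl_inl] at hxy
        simp only [Sum.map_inl, Sum.inl.injEq] at heq
        by_contra hcon
        refine c.valid ?_ heq
        rw [deleteEdges_adj]
        refine ⟨hxy, ?_⟩
        simp only [Set.mem_singleton_iff, Sym2.eq_iff]
        simpa using hcon
      · simp at heq
      · simp at heq
      · simp_all
    · exact hoff a j
    · rw [Sym2.eq_swap]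
      exact hoff b i
    · obtain ⟨c⟩ := h.1
      have hij : i ≠ j := by simpa using hab
      -- `F` uses `m + 1` colours and `j` shares the colour of `i`, for a total of `(m + 1) + (k -
      -- 1)`.
      refine colorable_deleteEdges (α := Fin (m + 1) ⊕ {x : Fin k // x ≠ j})
        (Sum.map c fun x => if hx : x = j then ⟨i, hij⟩ else ⟨x, hx⟩) ?_ ?_
      · have : 0 < k := i.pos
        simp [Fintype.card_subtype_compl]
        omega
      · rintro (x | x) (y | y) hxy heq
        · exact absurd (Sum.inl.inj heq) (c.valid (by simpa using hxy))
        · simp at heq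
        · simp at heq
        · simp only [Sum.map_inr, Sum.inr.injEq] at heq
          simp only [addSimplicial_inr_inr] at hxy
          grind

/-- A colouring inside `s` extends, with private colours for the vertices outside. -/
lemma Colorable.of_induce [Fintype V] {s : Finset V}
    (h : (G.induce (s : Set V)).Colorable m) (hcard : Fintype.card V = s.card + k) :
    G.Colorable (m + k) := by
  classical
  obtain ⟨c⟩ := h
  refine colorable_of_card_le (α := Fin m ⊕ {x // x ∉ s})
    (fun v => if hv : v ∈ s then Sum.inl (c ⟨v, hv⟩) else Sum.inr ⟨v, hv⟩) ?_ ?_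
  · intro x y hxy heq
    by_cases hx : x ∈ s <;> by_cases hy : y ∈ s <;> simp [hx, hy] at heq
    · exact c.valid (by simpa using hxy) heq
    · exact hxy.ne heq
  · simp [Fintype.card_subtype_compl]
    omega

/-- If all vertices outside `s` are universal, a copy inside `s` extends to its join with a
complete graph. -/
lemma IsContained.addSimplicial [Fintype V] {s : Finset V}
    (h : F ⊑ G.induce (s : Set V)) (hcard : Fintype.card V = s.card + k)
    (hs : ∀ v ∉ s, ∀ w, v ≠ w → G.Adj v w) : F.addSimplicial k ⊑ G := by
  classical
  obtain ⟨f⟩ := h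
  have hk : Fintype.card {x // x ∉ s} = k := by
    rw [Fintype.card_subtype_compl, Fintype.card_coe]
    omega
  let e : Fin k ≃ {x // x ∉ s} := (Fintype.equivFinOfCardEq hk).symm
  have hne : ∀ (w : W) (i : Fin k), (f w : V) ≠ e i := fun w i heq =>
    (e i).2 (heq ▸ (f w).2)
  refine ⟨⟨⟨Sum.elim (fun w => (f w : V)) (fun i => (e i : V)), ?_⟩, ?_⟩⟩
  · rintro (x | x) (y | y) hxy
    · exact f.toHom.map_adj (addSimplicial_inl_inl.mp hxy)
    · exact (hs _ (e y).2 _ (hne x y).symm).symm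
    · exact hs _ (e x).2 _ (hne y x).symm
    · refine hs _ (e x).2 _ ?_
      exact fun h => addSimplicial_inr_inr.mp hxy (e.injective (Subtype.ext h))
  · rintro (x | x) (y | y) hxy
    · exact congrArg Sum.inl (f.injective (Subtype.ext hxy))
    · exact absurd hxy (hne x y)
    · exact absurd hxy.symm (hne y x)
    · exact congrArg Sum.inr (e.injective (Subtype.ext hxy))

end Join

/-! ### The four small graphs -/

section Concrete

/-- The wheel with five spokes and hub `0`. -/
def wheelFive : SimpleGraph (Fin 6) :=
  fromEdgeSet {s(0, 1), s(0, 2), s(0, 3), s(0, 4), s(0, 5),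
    s(1, 2), s(2, 3), s(3, 4), s(4, 5), s(5, 1)}

instance : DecidableRel moserSpindle.Adj := by
  unfold moserSpindle
  infer_instance

instance : DecidableRel cappedSun.Adj := by
  unfold cappedSun
  infer_instance

instance : DecidableRel wheelFive.Adj := by
  unfold wheelFive
  infer_instance

lemma not_colorable_moserSpindle : ¬ moserSpindle.Colorable 3 := by
  rintro ⟨c⟩
  have key : ∀ a : Fin 3, ∀ b : Fin 3, a ≠ b → ∀ c : Fin 3, a ≠ c → b ≠ c → ∀ d : Fin 3, a ≠ d →
      ∀ e : Fin 3, a ≠ e → d ≠ e → ∀ f : Fin 3, b ≠ f → c ≠ f → ∀ g : Fin 3, d ≠ g → e ≠ g → f ≠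
      g → False := by decide
  exact key (c 0) (c 1) (c.valid (by decide)) (c 2) (c.valid (by decide)) (c.valid (by decide))
    (c 3) (c.valid (by decide)) (c 4) (c.valid (by decide)) (c.valid (by decide)) (c 5) (c.valid
    (by decide)) (c.valid (by decide)) (c 6) (c.valid (by decide)) (c.valid (by decide))
    (c.valid (by decide))

lemma not_colorable_cappedSun : ¬ cappedSun.Colorable 3 := by
  rintro ⟨c⟩
  have key : ∀ a : Fin 3, ∀ b : Fin 3, a ≠ b → ∀ c : Fin 3, a ≠ c → b ≠ c → ∀ d : Fin 3, d ≠ a →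
      d ≠ b → ∀ e : Fin 3, e ≠ a → e ≠ c → ∀ f : Fin 3, f ≠ b → f ≠ c → ∀ g : Fin 3, g ≠ d → g ≠
      e → g ≠ f → False := by decide
  exact key (c 0) (c 1) (c.valid (by decide)) (c 2) (c.valid (by decide)) (c.valid (by decide))
    (c 3) (c.valid (by decide)) (c.valid (by decide)) (c 4) (c.valid (by decide)) (c.valid (by
    decide)) (c 5) (c.valid (by decide)) (c.valid (by decide)) (c 6) (c.valid (by decide))
    (c.valid (by decide)) (c.valid (by decide))

lemma not_colorable_wheelFive : ¬ wheelFive.Colorable 3 := by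
  rintro ⟨c⟩
  have key : ∀ a : Fin 3, ∀ b : Fin 3, a ≠ b → ∀ c : Fin 3, a ≠ c → b ≠ c → ∀ d : Fin 3, a ≠ d →
      c ≠ d → ∀ e : Fin 3, a ≠ e → d ≠ e → ∀ f : Fin 3, a ≠ f → e ≠ f → f ≠ b → False := by
      decide
  exact key (c 0) (c 1) (c.valid (by decide)) (c 2) (c.valid (by decide)) (c.valid (by decide))
    (c 3) (c.valid (by decide)) (c.valid (by decide)) (c 4) (c.valid (by decide)) (c.valid (by
    decide)) (c 5) (c.valid (by decide)) (c.valid (by decide)) (c.valid (by decide))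

lemma not_colorable_completeGraph_four : ¬ (completeGraph (Fin 4)).Colorable 3 := by
  rintro ⟨c⟩
  obtain ⟨i, j, hij, h⟩ := Fintype.exists_ne_map_eq_of_card_lt c (by simp)
  exact c.valid (by simpa [completeGraph] using hij) h

lemma isEdgeCritical_moserSpindle : moserSpindle.IsEdgeCritical 3 := by
  refine ⟨colorable_of_card_le (α := Fin 4) ![0, 1, 2, 1, 2, 0, 3] (by decide) (by simp),
    not_colorable_moserSpindle, by decide, ?_⟩
  intro a b hab
  have h := fun {a b} (c : Fin 7 → Fin 3) =>
    colorable_deleteEdges (G := moserSpindle) (m := 3) (a := a) (b := b) c (by simp)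
  have hab' := ((fromEdgeSet_adj _).mp hab).1
  revert hab'
  generalize s(a, b) = e
  rintro (rfl | rfl | rfl | rfl | rfl | rfl | rfl | rfl | rfl | rfl | rfl)
  -- In each colouring the deleted edge is the only one with equal colours at its ends.
  · exact h ![0, 0, 1, 1, 2, 2, 0] (by decide)
  · exact h ![0, 1, 0, 1, 2, 2, 0] (by decide)
  · exact h ![0, 1, 1, 1, 2, 2, 0] (by decide)
  · exact h ![0, 1, 2, 1, 2, 1, 0] (by decide)
  · exact h ![0, 1, 2, 1, 2, 2, 0] (by decide)
  · exact h ![0, 1, 2, 0, 1, 0, 2] (by decide)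
  · exact h ![0, 1, 2, 1, 0, 0, 2] (by decide)
  · exact h ![0, 1, 2, 1, 1, 0, 2] (by decide)
  · exact h ![0, 1, 2, 1, 2, 0, 1] (by decide)
  · exact h ![0, 1, 2, 1, 2, 0, 2] (by decide)
  · exact h ![0, 1, 2, 1, 2, 0, 0] (by decide)

lemma isEdgeCritical_cappedSun : cappedSun.IsEdgeCritical 3 := by
  refine ⟨colorable_of_card_le (α := Fin 4) ![0, 1, 2, 2, 1, 0, 3] (by decide) (by simp),
    not_colorable_cappedSun, by decide, ?_⟩
  intro a b hab
  have h := fun {a b} (c : Fin 7 → Fin 3) =>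
    colorable_deleteEdges (G := cappedSun) (m := 3) (a := a) (b := b) c (by simp)
  have hab' := ((fromEdgeSet_adj _).mp hab).1
  revert hab'
  generalize s(a, b) = e
  rintro (rfl | rfl | rfl | rfl | rfl | rfl | rfl | rfl | rfl | rfl | rfl | rfl)
  · exact h ![0, 0, 1, 1, 2, 2, 0] (by decide)
  · exact h ![0, 1, 0, 2, 1, 2, 0] (by decide)
  · exact h ![0, 1, 1, 2, 2, 0, 1] (by decide)
  · exact h ![0, 1, 2, 0, 1, 0, 2] (by decide)
  · exact h ![0, 1, 2, 1, 1, 0, 2] (by decide)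
  · exact h ![0, 1, 2, 2, 0, 0, 1] (by decide)
  · exact h ![0, 1, 2, 2, 2, 0, 1] (by decide)
  · exact h ![0, 1, 2, 2, 1, 1, 0] (by decide)
  · exact h ![0, 1, 2, 2, 1, 2, 0] (by decide)
  · exact h ![0, 1, 2, 2, 1, 0, 2] (by decide)
  · exact h ![0, 1, 2, 2, 1, 0, 1] (by decide)
  · exact h ![0, 1, 2, 2, 1, 0, 0] (by decide)

end Concrete

/-! ### Graphs covered by four vertices and an independent set -/

section SevenVertices

variable {V : Type*} {G : SimpleGraph V}

lemma nodup_six_iff {a b c d e f : V} : [a, b, c, d, e, f].Nodup ↔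
    (a ≠ b ∧ a ≠ c ∧ a ≠ d ∧ a ≠ e ∧ a ≠ f) ∧ (b ≠ c ∧ b ≠ d ∧ b ≠ e ∧ b ≠ f) ∧
    (c ≠ d ∧ c ≠ e ∧ c ≠ f) ∧ (d ≠ e ∧ d ≠ f) ∧ e ≠ f := by
  simp only [List.nodup_cons, List.mem_cons, List.not_mem_nil, not_or, or_false, not_false_eq_true,
    List.nodup_nil, and_true, ne_eq]

lemma nodup_seven_iff {a b c d e f g : V} : [a, b, c, d, e, f, g].Nodup ↔
    (a ≠ b ∧ a ≠ c ∧ a ≠ d ∧ a ≠ e ∧ a ≠ f ∧ a ≠ g) ∧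
    (b ≠ c ∧ b ≠ d ∧ b ≠ e ∧ b ≠ f ∧ b ≠ g) ∧ (c ≠ d ∧ c ≠ e ∧ c ≠ f ∧ c ≠ g) ∧
    (d ≠ e ∧ d ≠ f ∧ d ≠ g) ∧ (e ≠ f ∧ e ≠ g) ∧ f ≠ g := by
  simp only [List.nodup_cons, List.mem_cons, List.not_mem_nil, not_or, or_false, not_false_eq_true,
    List.nodup_nil, and_true, ne_eq]

lemma fromEdgeSet_isContained {W : Type*} {S : Set (Sym2 W)} (f : W → V)
    (hf : Function.Injective f) (h : ∀ e ∈ S, e.map f ∈ G.edgeSet) : fromEdgeSet S ⊑ G :=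
  ⟨⟨⟨f, fun {a b} hab => by simpa using h s(a, b) ((fromEdgeSet_adj S).mp hab).1⟩, hf⟩⟩

lemma completeGraph_four_isContained {a b c d : V} (hab : G.Adj a b) (hac : G.Adj a c)
    (had : G.Adj a d) (hbc : G.Adj b c) (hbd : G.Adj b d) (hcd : G.Adj c d) :
    completeGraph (Fin 4) ⊑ G := by
  have key : ∀ i j : Fin 4, i ≠ j → G.Adj (![a, b, c, d] i) (![a, b, c, d] j) := by
    intro i j hij
    fin_cases i <;> fin_cases j <;> simp_all [adj_comm]
  refine ⟨⟨⟨![a, b, c, d], fun {i j} h => key i j (by simpa [completeGraph] using h)⟩, ?_⟩⟩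
  intro i j hij
  by_contra hne
  exact (key i j hne).ne hij

lemma wheelFive_isContained {v a b c d e : V} (hn : [v, a, b, c, d, e].Nodup) (ha : G.Adj v a)
    (hb : G.Adj v b) (hc : G.Adj v c) (hd : G.Adj v d) (he : G.Adj v e) (hab : G.Adj a b)
    (hbc : G.Adj b c) (hcd : G.Adj c d) (hde : G.Adj d e) (hea : G.Adj e a) :
    wheelFive ⊑ G := by
  refine fromEdgeSet_isContained ![v, a, b, c, d, e] (List.nodup_ofFn.mp (by simpa using hn)) ?_
  simp [*]

lemma moserSpindle_isContained {v a b c d u w : V} (hn : [v, a, b, c, d, u, w].Nodup)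
    (ha : G.Adj v a) (hb : G.Adj v b) (hc : G.Adj v c) (hd : G.Adj v d) (hab : G.Adj a b)
    (hcd : G.Adj c d) (hau : G.Adj a u) (hbu : G.Adj b u) (hcw : G.Adj c w) (hdw : G.Adj d w)
    (huw : G.Adj u w) : moserSpindle ⊑ G := by
  refine fromEdgeSet_isContained ![v, a, b, c, d, u, w]
    (List.nodup_ofFn.mp (by simpa using hn)) ?_
  simp [*]

lemma cappedSun_isContained {x y z p q r w : V} (hn : [x, y, z, p, q, r, w].Nodup)
    (hxy : G.Adj x y) (hxz : G.Adj x z) (hyz : G.Adj y z) (hpx : G.Adj p x) (hpy : G.Adj p y)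
    (hqx : G.Adj q x) (hqz : G.Adj q z) (hry : G.Adj r y) (hrz : G.Adj r z)
    (hwp : G.Adj w p) (hwq : G.Adj w q) (hwr : G.Adj w r) : cappedSun ⊑ G := by
  refine fromEdgeSet_isContained ![x, y, z, p, q, r, w]
    (List.nodup_ofFn.mp (by simpa using hn)) ?_
  simp [*]

/-- If the vertices outside `{x, y, z, w}` are independent, `z` and `w` are nonadjacent and
three colours do not suffice, then some vertex outside sees `x`, `y` and one of `z`, `w`. -/
lemma exists_adj_of_not_colorable (hG : ¬ G.Colorable 3) {D : Set V} {x y z w : V}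
    (hD : ∀ v, v ∈ D ↔ v = x ∨ v = y ∨ v = z ∨ v = w)
    (hI : ∀ u v, u ∉ D → v ∉ D → ¬ G.Adj u v) (hzw : ¬ G.Adj w z) :
    ∃ v, v ∉ D ∧ G.Adj v x ∧ G.Adj v y ∧ (G.Adj v z ∨ G.Adj v w) := by
  classical
  by_contra! hcon
  apply hG
  -- `x`, `y` and the pair `z`, `w` get the three colours; each outside vertex takes a free one,
  -- which exists unless it sees all three.
  refine colorable_of_card_le (α := Fin 3) (fun v => if v = x then 0 else if v = y then 1 else
    if v = z ∨ v = w then 2 else if ¬ G.Adj v x then 0 else if ¬ G.Adj v y then 1 else 2) ?_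
    (by simp)
  intro u v huv
  have h1 := huv.symm
  have h2 := huv.ne
  have h3 := hcon u
  have h4 := hcon v
  have h5 := hI u v
  have h6 : ¬ G.Adj z w := fun h => hzw h.symm
  rw [hD] at h3 h4 h5
  rw [hD] at h5
  clear hcon hI hD
  split_ifs <;> grind

/-- Otherwise the outside vertices and the two pairs would be three colour classes. -/
lemma adj_or_adj_of_not_colorable (hG : ¬ G.Colorable 3) {D : Set V} {x y z w : V}
    (hD : ∀ v, v ∈ D ↔ v = x ∨ v = y ∨ v = z ∨ v = w)
    (hI : ∀ u v, u ∉ D → v ∉ D → ¬ G.Adj u v) : G.Adj x y ∨ G.Adj z w := by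
  classical
  by_contra! hcon
  apply hG
  refine colorable_of_card_le (α := Fin 3) (fun v => if v ∉ D then 0 else
    if v = x ∨ v = y then 1 else 2) ?_ (by simp)
  intro u v huv
  have h1 := huv.symm
  have h2 := huv.ne
  have h3 := hI u v
  have h4 := hD u
  have h5 := hD v
  clear hI hD
  split_ifs <;> grind

lemma exists_adj_three_of_not_colorable (hG : ¬ G.Colorable 3) {D : Set V} {x y z w : V}
    (hD : ∀ v, v ∈ D ↔ v = x ∨ v = y ∨ v = z ∨ v = w)
    (hI : ∀ u v, u ∉ D → v ∉ D → ¬ G.Adj u v) : G.Adj x y ∨ G.Adj y z ∨ G.Adj x z := by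
  classical
  by_contra! hcon
  apply hG
  refine colorable_of_card_le (α := Fin 3) (fun v => if v ∉ D then 0 else
    if v = w then 1 else 2) ?_ (by simp)
  intro u v huv
  have h1 := huv.symm
  have h2 := huv.ne
  have h3 := hI u v
  have h4 := hD u
  have h5 := hD v
  clear hI hD
  split_ifs <;> grind

/-- If the vertices outside a four-element set are independent, the set contains a triangle. -/
lemma exists_triangle_of_not_colorable (hG : ¬ G.Colorable 3) {D : Set V} {x y z w : V}
    (hD : ∀ v, v ∈ D ↔ v = x ∨ v = y ∨ v = z ∨ v = w)
    (hI : ∀ u v, u ∉ D → v ∉ D → ¬ G.Adj u v) :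
    (G.Adj x y ∧ G.Adj y z ∧ G.Adj x z) ∨ (G.Adj x y ∧ G.Adj y w ∧ G.Adj x w) ∨
    (G.Adj x z ∧ G.Adj z w ∧ G.Adj x w) ∨ (G.Adj y z ∧ G.Adj z w ∧ G.Adj y w) := by
  -- The four vertices do not induce a bipartite graph: no split into two pairs, or a triple and a
  -- single vertex, works. An odd cycle on four vertices is a triangle.
  have p₁ := adj_or_adj_of_not_colorable hG hD hI
  have p₂ := adj_or_adj_of_not_colorable hG (x := x) (y := z) (z := y) (w := w)
    (fun v => (hD v).trans (iff_of_eq (by ac_rfl))) hI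
  have p₃ := adj_or_adj_of_not_colorable hG (x := x) (y := w) (z := y) (w := z)
    (fun v => (hD v).trans (iff_of_eq (by ac_rfl))) hI
  have t₁ := exists_adj_three_of_not_colorable hG hD hI
  have t₂ := exists_adj_three_of_not_colorable hG (x := x) (y := y) (z := w) (w := z)
    (fun v => (hD v).trans (iff_of_eq (by ac_rfl))) hI
  have t₃ := exists_adj_three_of_not_colorable hG (x := x) (y := z) (z := w) (w := y)
    (fun v => (hD v).trans (iff_of_eq (by ac_rfl))) hI
  have t₄ := exists_adj_three_of_not_colorable hG (x := y) (y := z) (z := w) (w := x)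
    (fun v => (hD v).trans (iff_of_eq (by ac_rfl))) hI
  clear hD hI hG
  grind

/-- A graph that is not 3-colourable and has a triangle `x y z` and a further vertex `w` such
that the remaining vertices are independent contains one of three graphs. -/
lemma isContained_of_triangle (hG : ¬ G.Colorable 3) {D : Set V} {x y z w : V}
    (hxy : G.Adj x y) (hyz : G.Adj y z) (hxz : G.Adj x z)
    (hw : w ≠ x ∧ w ≠ y ∧ w ≠ z) (hD : ∀ v, v ∈ D ↔ v = x ∨ v = y ∨ v = z ∨ v = w)
    (hI : ∀ u v, u ∉ D → v ∉ D → ¬ G.Adj u v) :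
    completeGraph (Fin 4) ⊑ G ∨ wheelFive ⊑ G ∨ cappedSun ⊑ G := by
  by_contra hcon
  simp only [not_or] at hcon
  obtain ⟨hK, hW, hS⟩ := hcon
  have noK : ∀ {a b c d}, G.Adj a b → G.Adj a c → G.Adj b c → G.Adj d a → G.Adj d b →
      ¬ G.Adj d c := fun h₁ h₂ h₃ h₄ h₅ h₆ =>
    hK (completeGraph_four_isContained h₄ h₅ h₆ h₁ h₂ h₃)
  have apex : ∀ {x y z}, G.Adj x y → G.Adj y z → G.Adj x z →
      (∀ v, v ∈ D ↔ v = x ∨ v = y ∨ v = z ∨ v = w) → ¬ G.Adj w z →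
      ∃ v, v ∉ D ∧ G.Adj v x ∧ G.Adj v y ∧ G.Adj v w ∧ ¬ G.Adj v z := by
    intro x y z hxy hyz hxz hD hwz
    obtain ⟨v, hv, hvx, hvy, hvz⟩ := exists_adj_of_not_colorable hG hD hI hwz
    have := noK hxy hxz hyz hvx hvy
    exact ⟨v, hv, hvx, hvy, hvz.resolve_left this, this⟩
  -- A vertex seeing `x`, `y` and `w` would complete a K₄ with them.
  have two : ∀ {x y z}, G.Adj x y → G.Adj y z → G.Adj x z →
      (∀ v, v ∈ D ↔ v = x ∨ v = y ∨ v = z ∨ v = w) → G.Adj w x → ¬ G.Adj w y := by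
    intro x y z hxy hyz hxz hD hwx hwy
    have hwz : ¬ G.Adj w z := noK hxy hxz hyz hwx hwy
    obtain ⟨v, -, hvx, hvy, hvw, -⟩ := apex hxy hyz hxz hD hwz
    exact noK hxy hwx.symm hwy.symm hvx hvy hvw
  -- If `w` sees only `x`, the two apexes close a 5-cycle `y z q w p` around the hub `x`.
  have one : ∀ {x y z}, G.Adj x y → G.Adj y z → G.Adj x z → w ≠ y → w ≠ z →
      (∀ v, v ∈ D ↔ v = x ∨ v = y ∨ v = z ∨ v = w) → ¬ G.Adj w x := by
    intro x y z hxy hyz hxz hwy' hwz' hD hwx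
    have hD' : ∀ v, v ∈ D ↔ v = x ∨ v = z ∨ v = y ∨ v = w :=
      fun v => (hD v).trans (iff_of_eq (by ac_rfl))
    have hwy := two hxy hyz hxz hD hwx
    have hwz := two hxz hyz.symm hxy hD' hwx
    obtain ⟨p, hp, hpx, hpy, hpw, hpz⟩ := apex hxy hyz hxz hD hwz
    obtain ⟨q, hq, hqx, hqz, hqw, hqy⟩ := apex hxz hyz.symm hxy hD' hwy
    refine hW (wheelFive_isContained (v := x) (a := y) (b := z) (c := q) (d := w) (e := p) ?_
      hxy hxz hqx.symm hwx.symm hpx.symm hyz hqz.symm hqw hpw.symm hpy)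
    have h₁ : p ≠ q := by rintro rfl; exact hpz hqz
    have h₂ := hxy.ne
    have h₃ := hxz.ne
    have h₄ := hyz.ne
    have h₅ := hwx.ne
    rw [hD] at hp hq
    rw [nodup_six_iff]
    clear apex two noK hI hD hD'
    grind
  have hD₁ : ∀ v, v ∈ D ↔ v = x ∨ v = z ∨ v = y ∨ v = w :=
    fun v => (hD v).trans (iff_of_eq (by ac_rfl))
  have hD₂ : ∀ v, v ∈ D ↔ v = y ∨ v = z ∨ v = x ∨ v = w :=
    fun v => (hD v).trans (iff_of_eq (by ac_rfl))
  have hD₃ : ∀ v, v ∈ D ↔ v = z ∨ v = x ∨ v = y ∨ v = w :=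
    fun v => (hD v).trans (iff_of_eq (by ac_rfl))
  have hwx := one hxy hyz hxz hw.2.1 hw.2.2 hD
  have hwy := one hyz hxz.symm hxy.symm hw.2.2 hw.1 hD₂
  have hwz := one hxz.symm hxy hyz.symm hw.1 hw.2.1 hD₃
  obtain ⟨p, hp, hpx, hpy, hpw, hpz⟩ := apex hxy hyz hxz hD hwz
  obtain ⟨q, hq, hqx, hqz, hqw, hqy⟩ := apex hxz hyz.symm hxy hD₁ hwy
  obtain ⟨r, hr, hry, hrz, hrw, hrx⟩ := apex hyz hxz.symm hxy.symm hD₂ hwx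
  refine hS (cappedSun_isContained ?_ hxy hxz hyz hpx hpy hqx hqz hry hrz hpw.symm hqw.symm
    hrw.symm)
  have h₁ : p ≠ q := by rintro rfl; exact hpz hqz
  have h₂ : p ≠ r := by rintro rfl; exact hrx hpx
  have h₃ : q ≠ r := by rintro rfl; exact hrx hqx
  have h₄ := hxy.ne
  have h₅ := hxz.ne
  have h₆ := hyz.ne
  rw [hD] at hp hq hr
  rw [nodup_seven_iff]
  clear apex two one noK hI hD hD₁ hD₂ hD₃
  grind

end SevenVertices

/-! ### Neighbourhoods in graphs without K₄ and independent triple -/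

section NoIndependentTriple

variable {V : Type*} {G : SimpleGraph V}

/-- Five neighbours of a vertex, without triangle and independent triple, span a pentagon. -/
lemma wheelFive_isContained_of_five {v a b c d e : V} (hn : [v, a, b, c, d, e].Nodup)
    (hK : ¬ completeGraph (Fin 4) ⊑ G)
    (hI : ∀ {p q r}, p ≠ q → p ≠ r → q ≠ r → G.Adj p q ∨ G.Adj p r ∨ G.Adj q r)
    (ha : G.Adj v a) (hb : G.Adj v b) (hc : G.Adj v c) (hd : G.Adj v d) (he : G.Adj v e) :
    wheelFive ⊑ G := by
  by_contra hW
  have noT : ∀ {p q r}, G.Adj v p → G.Adj v q → G.Adj v r → G.Adj p q → G.Adj p r →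
      ¬ G.Adj q r := fun h₁ h₂ h₃ h₄ h₅ h₆ =>
    hK (completeGraph_four_isContained h₁ h₂ h₃ h₄ h₅ h₆)
  have main : ∀ {a b c d e}, [v, a, b, c, d, e].Nodup → G.Adj v a → G.Adj v b → G.Adj v c →
      G.Adj v d → G.Adj v e → G.Adj a b → G.Adj a c → ¬ G.Adj a d → ¬ G.Adj a e → False := by
    intro a b c d e hn ha hb hc hd he hab hac had hae
    rw [nodup_six_iff] at hn
    have hn' := hn
    obtain ⟨-, ⟨nab, nac, nad, nae⟩, ⟨nbc, nbd, nbe⟩, ⟨ncd, nce⟩, nde⟩ := hn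
    have hbc := noT ha hb hc hab hac
    have hde : G.Adj d e := ((hI nad nae nde).resolve_left had).resolve_left hae
    have t₁ := noT hb hd he
    have t₂ := noT hc hd he
    have i₁ := hI nbc nbd ncd
    have i₂ := hI nbc nbe nce
    have w₁ : G.Adj b d → ¬ G.Adj c e := fun h h' =>
      hW (wheelFive_isContained (v := v) (a := a) (b := b) (c := d) (d := e) (e := c)
        (by rw [nodup_six_iff]; clear noT hI; grind) ha hb hd he hc hab h hde h'.symm hac.symm)
    have w₂ : G.Adj b e → ¬ G.Adj c d := fun h h' =>
      hW (wheelFive_isContained (v := v) (a := a) (b := b) (c := e) (d := d) (e := c)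
        (by rw [nodup_six_iff]; clear noT hI; grind) ha hb he hd hc hab h hde.symm h'.symm hac.symm)
    clear hI noT hn' hW hK
    grind
  rw [nodup_six_iff] at hn
  have hn' := hn
  obtain ⟨-, ⟨nab, nac, nad, nae⟩, ⟨nbc, nbd, nbe⟩, ⟨ncd, nce⟩, nde⟩ := hn
  -- Among any three of the other four, `a` sees some but not all; hence it sees exactly two of the
  -- four, as `main` requires.
  have three : ∀ {p q r}, p ≠ q → p ≠ r → q ≠ r → a ≠ p → a ≠ q → a ≠ r → G.Adj v p →
      G.Adj v q → G.Adj v r → (¬ (G.Adj a p ∧ G.Adj a q ∧ G.Adj a r)) ∧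
      (G.Adj a p ∨ G.Adj a q ∨ G.Adj a r) := by
    intro p q r hpq hpr hqr hap haq har hp hq hr
    constructor
    · rintro ⟨h₁, h₂, h₃⟩
      rcases hI hpq hpr hqr with h | h | h
      · exact noT ha hp hq h₁ h₂ h
      · exact noT ha hp hr h₁ h₃ h
      · exact noT ha hq hr h₂ h₃ h
    · by_contra! h
      obtain ⟨h₁, h₂, h₃⟩ := h
      exact noT hp hq hr (((hI hap haq hpq).resolve_left h₁).resolve_left h₂)
        (((hI hap har hpr).resolve_left h₁).resolve_left h₃)
        (((hI haq har hqr).resolve_left h₂).resolve_left h₃)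
  have s₁ := three nbc nbd ncd nab nac nad hb hc hd
  have s₂ := three nbc nbe nce nab nac nae hb hc he
  have s₃ := three nbd nbe nde nab nad nae hb hd he
  have s₄ := three ncd nce nde nac nad nae hc hd he
  have m₁ := main (a := a) (b := b) (c := c) (d := d) (e := e)
    (nodup_six_iff.mpr hn') ha hb hc hd he
  have m₂ := main (a := a) (b := b) (c := d) (d := c) (e := e)
    (by rw [nodup_six_iff]; clear main three noT hI; grind) ha hb hd hc he
  have m₃ := main (a := a) (b := b) (c := e) (d := c) (e := d)
    (by rw [nodup_six_iff]; clear main three noT hI; grind) ha hb he hc hd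
  have m₄ := main (a := a) (b := c) (c := d) (d := b) (e := e)
    (by rw [nodup_six_iff]; clear main three noT hI; grind) ha hc hd hb he
  have m₅ := main (a := a) (b := c) (c := e) (d := b) (e := d)
    (by rw [nodup_six_iff]; clear main three noT hI; grind) ha hc he hb hd
  have m₆ := main (a := a) (b := d) (c := e) (d := b) (e := c)
    (by rw [nodup_six_iff]; clear main three noT hI; grind) ha hd he hb hc
  clear main three noT hI hn' hW hK
  grind

/-- The case that a nonneighbour `u` of `v` is adjacent to both ends of an edge `a b` of the
neighbourhood of `v`. -/
lemma moserSpindle_isContained_of_adj_adj {v a b c d u w : V}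
    (hn : [v, a, b, c, d, u, w].Nodup) (hK : ¬ completeGraph (Fin 4) ⊑ G)
    (hI : ∀ {p q r}, p ≠ q → p ≠ r → q ≠ r → G.Adj p q ∨ G.Adj p r ∨ G.Adj q r)
    (ha : G.Adj v a) (hb : G.Adj v b) (hc : G.Adj v c) (hd : G.Adj v d) (hab : G.Adj a b)
    (hcd : G.Adj c d) (huw : G.Adj u w) (hua : G.Adj u a) (hub : G.Adj u b) :
    moserSpindle ⊑ G := by
  by_contra hM
  have noK : ∀ {p q r s}, G.Adj p q → G.Adj p r → G.Adj p s → G.Adj q r → G.Adj q s →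
      ¬ G.Adj r s := fun h₁ h₂ h₃ h₄ h₅ h₆ =>
    hK (completeGraph_four_isContained h₁ h₂ h₃ h₄ h₅ h₆)
  -- If `w` misses `b` and `c`, the absence of independent triples and K₄ forces `b c`, `w a`, `w
  -- d`: a spindle centred at `b`.
  have main : ∀ {a b c d}, [v, a, b, c, d, u, w].Nodup → G.Adj v a → G.Adj v b → G.Adj v c →
      G.Adj v d → G.Adj a b → G.Adj c d → G.Adj u a → G.Adj u b → ¬ G.Adj w b →
      ¬ G.Adj w c → False := by
    intro a b c d hn ha hb hc hd hab hcd hua hub hwb hwc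
    rw [nodup_seven_iff] at hn
    obtain ⟨⟨nva, nvb, nvc, nvd, nvu, nvw⟩, ⟨nab, nac, nad, nau, naw⟩, ⟨nbc, nbd, nbu, nbw⟩,
      ⟨ncd, ncu, ncw⟩, ⟨ndu, ndw⟩, nuw⟩ := hn
    have hbc : G.Adj b c := by
      rcases hI nbw.symm ncw.symm nbc with h | h | h
      exacts [absurd h hwb, absurd h hwc, h]
    have hwa : G.Adj w a := by
      rcases hI naw.symm ncw.symm nac with h | h | h
      exacts [h, absurd h hwc, absurd hbc (noK ha hb hc hab h)]
    have hwd : G.Adj w d := by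
      rcases hI nbw.symm ndw.symm nbd with h | h | h
      exacts [absurd h hwb, h, absurd hcd (noK hb hc hd hbc h)]
    refine hM (moserSpindle_isContained (v := b) (a := a) (b := u) (c := v) (d := c) (u := w)
      (w := d) ?_ hab.symm hub.symm hb.symm hbc hua.symm hc hwa.symm huw hd hcd hwd)
    rw [nodup_seven_iff]
    grind only
  rw [nodup_seven_iff] at hn
  have hw₁ : ¬ (G.Adj w a ∧ G.Adj w b) := fun h =>
    noK huw hua hub h.1 h.2 hab
  have hw₂ : ¬ (G.Adj w c ∧ G.Adj w d) := fun h =>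
    hM (moserSpindle_isContained (nodup_seven_iff.mpr hn) ha hb hc hd hab hcd hua.symm hub.symm
      h.1.symm h.2.symm huw)
  have n₁ : [v, b, a, c, d, u, w].Nodup := by rw [nodup_seven_iff]; clear noK hI main; grind
  have n₂ : [v, a, b, d, c, u, w].Nodup := by rw [nodup_seven_iff]; clear noK hI main; grind
  have n₃ : [v, b, a, d, c, u, w].Nodup := by rw [nodup_seven_iff]; clear noK hI main; grind
  by_cases h₁ : G.Adj w a
  · have h₂ : ¬ G.Adj w b := fun h => hw₁ ⟨h₁, h⟩
    by_cases h₃ : G.Adj w c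
    · exact main n₂ ha hb hd hc hab hcd.symm hua hub h₂ fun h => hw₂ ⟨h₃, h⟩
    · exact main (nodup_seven_iff.mpr hn) ha hb hc hd hab hcd hua hub h₂ h₃
  · by_cases h₃ : G.Adj w c
    · exact main n₃ hb ha hd hc hab.symm hcd.symm hub hua h₁ fun h => hw₂ ⟨h₃, h⟩
    · exact main n₁ hb ha hc hd hab.symm hcd hub hua h₁ h₃

/-- The case that each of the nonneighbours `u`, `w` of `v` misses an end of each of the edges
`a b` and `c d` of the neighbourhood of `v`. -/
lemma moserSpindle_isContained_of_not_adj {v a b c d u w : V}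
    (hn : [v, a, b, c, d, u, w].Nodup) (hK : ¬ completeGraph (Fin 4) ⊑ G)
    (hI : ∀ {p q r}, p ≠ q → p ≠ r → q ≠ r → G.Adj p q ∨ G.Adj p r ∨ G.Adj q r)
    (ha : G.Adj v a) (hb : G.Adj v b) (hc : G.Adj v c) (hd : G.Adj v d) (hab : G.Adj a b)
    (hcd : G.Adj c d) (huw : G.Adj u w) (hub : ¬ G.Adj u b) (huc : ¬ G.Adj u c)
    (hwab : ¬ (G.Adj w a ∧ G.Adj w b)) (hwcd : ¬ (G.Adj w c ∧ G.Adj w d)) :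
    moserSpindle ⊑ G := by
  by_contra hM
  have noK : ∀ {p q r s}, G.Adj p q → G.Adj p r → G.Adj p s → G.Adj q r → G.Adj q s →
      ¬ G.Adj r s := fun h₁ h₂ h₃ h₄ h₅ h₆ =>
    hK (completeGraph_four_isContained h₁ h₂ h₃ h₄ h₅ h₆)
  rw [nodup_seven_iff] at hn
  obtain ⟨⟨nva, nvb, nvc, nvd, nvu, nvw⟩, ⟨nab, nac, nad, nau, naw⟩, ⟨nbc, nbd, nbu, nbw⟩,
    ⟨ncd, ncu, ncw⟩, ⟨ndu, ndw⟩, nuw⟩ := hn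
  have hbc : G.Adj b c := by
    rcases hI nbu.symm ncu.symm nbc with h | h | h
    exacts [absurd h hub, absurd h huc, h]
  have hac : ¬ G.Adj a c := fun h => noK ha hb hc hab h hbc
  have hbd : ¬ G.Adj b d := fun h => noK hb hc hd hbc h hcd
  have hua : G.Adj u a := by
    rcases hI nau.symm ncu.symm nac with h | h | h
    exacts [h, absurd h huc, absurd h hac]
  have hud : G.Adj u d := by
    rcases hI nbu.symm ndu.symm nbd with h | h | h
    exacts [absurd h hub, h, absurd h hbd]
  have hwac : G.Adj w a ∨ G.Adj w c := by
    rcases hI naw.symm ncw.symm nac with h | h | h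
    exacts [Or.inl h, Or.inr h, absurd h hac]
  have hwbd : G.Adj w b ∨ G.Adj w d := by
    rcases hI nbw.symm ndw.symm nbd with h | h | h
    exacts [Or.inl h, Or.inr h, absurd h hbd]
  -- This spindle is centred at `a`; the one in `m₂` is centred at `v`, with the matching `a d`, `b
  -- c`.
  have m₁ : G.Adj w a → G.Adj w d → False := by
    intro hwa hwd
    refine hM (moserSpindle_isContained (v := a) (a := v) (b := b) (c := u) (d := w) (u := c)
      (w := d) ?_ ha.symm hab hua.symm hwa.symm hb huw hc hbc hud hwd hcd)
    rw [nodup_seven_iff]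
    grind only
  have m₂ : G.Adj w b → G.Adj w c → False := by
    intro hwb hwc
    have hwa : ¬ G.Adj w a := fun h => hwab ⟨h, hwb⟩
    have hwd : ¬ G.Adj w d := fun h => hwcd ⟨hwc, h⟩
    have had : G.Adj a d := by
      rcases hI naw.symm ndw.symm nad with h | h | h
      exacts [absurd h hwa, absurd h hwd, h]
    refine hM (moserSpindle_isContained (v := v) (a := a) (b := d) (c := b) (d := c) (u := u)
      (w := w) ?_ ha hd hb hc had hbc hua.symm hud.symm hwb.symm hwc.symm huw)
    rw [nodup_seven_iff]
    grind only
  rcases hwac with h | h <;> rcases hwbd with h' | h'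
  · exact hwab ⟨h, h'⟩
  · exact m₁ h h'
  · exact m₂ h' h
  · exact hwcd ⟨h, h'⟩

/-- A vertex of degree four with a perfect matching in its neighbourhood. -/
lemma moserSpindle_isContained_of_matching {v a b c d u w : V}
    (hn : [v, a, b, c, d, u, w].Nodup) (hK : ¬ completeGraph (Fin 4) ⊑ G)
    (hI : ∀ {p q r}, p ≠ q → p ≠ r → q ≠ r → G.Adj p q ∨ G.Adj p r ∨ G.Adj q r)
    (ha : G.Adj v a) (hb : G.Adj v b) (hc : G.Adj v c) (hd : G.Adj v d) (hab : G.Adj a b)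
    (hcd : G.Adj c d) (huw : G.Adj u w) : moserSpindle ⊑ G := by
  by_contra hM
  have hn₀ := hn
  rw [nodup_seven_iff] at hn
  have n₁ : [v, c, d, a, b, u, w].Nodup := by rw [nodup_seven_iff]; clear hI; grind
  have n₂ : [v, a, b, c, d, w, u].Nodup := by rw [nodup_seven_iff]; clear hI; grind
  have n₃ : [v, c, d, a, b, w, u].Nodup := by rw [nodup_seven_iff]; clear hI; grind
  have n₄ : [v, b, a, c, d, u, w].Nodup := by rw [nodup_seven_iff]; clear hI; grind
  have n₅ : [v, a, b, d, c, u, w].Nodup := by rw [nodup_seven_iff]; clear hI; grind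
  have n₆ : [v, b, a, d, c, u, w].Nodup := by rw [nodup_seven_iff]; clear hI; grind
  have h₁ : ¬ (G.Adj u a ∧ G.Adj u b) := fun h =>
    hM (moserSpindle_isContained_of_adj_adj hn₀ hK hI ha hb hc hd hab hcd huw h.1 h.2)
  have h₂ : ¬ (G.Adj u c ∧ G.Adj u d) := fun h =>
    hM (moserSpindle_isContained_of_adj_adj n₁ hK hI hc hd ha hb hcd hab huw h.1 h.2)
  have h₃ : ¬ (G.Adj w a ∧ G.Adj w b) := fun h =>
    hM (moserSpindle_isContained_of_adj_adj n₂ hK hI ha hb hc hd hab hcd huw.symm h.1 h.2)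
  have h₄ : ¬ (G.Adj w c ∧ G.Adj w d) := fun h =>
    hM (moserSpindle_isContained_of_adj_adj n₃ hK hI hc hd ha hb hcd hab huw.symm h.1 h.2)
  by_cases hua : G.Adj u a
  · have hub : ¬ G.Adj u b := fun h => h₁ ⟨hua, h⟩
    by_cases huc : G.Adj u c
    · exact hM (moserSpindle_isContained_of_not_adj n₅ hK hI ha hb hd hc hab hcd.symm huw hub
        (fun h => h₂ ⟨huc, h⟩) h₃ (fun h => h₄ h.symm))
    · exact hM (moserSpindle_isContained_of_not_adj hn₀ hK hI ha hb hc hd hab hcd huw hub huc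
        h₃ h₄)
  · by_cases huc : G.Adj u c
    · exact hM (moserSpindle_isContained_of_not_adj n₆ hK hI hb ha hd hc hab.symm hcd.symm huw
        hua (fun h => h₂ ⟨huc, h⟩) (fun h => h₃ h.symm) (fun h => h₄ h.symm))
    · exact hM (moserSpindle_isContained_of_not_adj n₄ hK hI hb ha hc hd hab.symm hcd huw hua
        huc (fun h => h₃ h.symm) h₄)

/-- A vertex with four neighbours and two adjacent further vertices. -/
lemma moserSpindle_isContained_of_four {v a b c d u w : V}
    (hn : [v, a, b, c, d, u, w].Nodup) (hK : ¬ completeGraph (Fin 4) ⊑ G)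
    (hI : ∀ {p q r}, p ≠ q → p ≠ r → q ≠ r → G.Adj p q ∨ G.Adj p r ∨ G.Adj q r)
    (ha : G.Adj v a) (hb : G.Adj v b) (hc : G.Adj v c) (hd : G.Adj v d) (huw : G.Adj u w) :
    moserSpindle ⊑ G := by
  have noT : ∀ {p q r}, G.Adj v p → G.Adj v q → G.Adj v r → G.Adj p q → G.Adj p r →
      ¬ G.Adj q r := fun h₁ h₂ h₃ h₄ h₅ h₆ =>
    hK (completeGraph_four_isContained h₁ h₂ h₃ h₄ h₅ h₆)
  have hn₀ := hn
  rw [nodup_seven_iff] at hn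
  have hn₁ := hn
  obtain ⟨⟨nva, nvb, nvc, nvd, nvu, nvw⟩, ⟨nab, nac, nad, nau, naw⟩, ⟨nbc, nbd, nbu, nbw⟩,
    ⟨ncd, ncu, ncw⟩, ⟨ndu, ndw⟩, nuw⟩ := hn₁
  have t₁ := noT ha hb hc
  have t₂ := noT ha hb hd
  have t₃ := noT ha hc hd
  have t₄ := noT hb hc hd
  have i₁ := hI nab nac nbc
  have i₂ := hI nab nad nbd
  have i₃ := hI nac nad ncd
  have i₄ := hI nbc nbd ncd
  have n₁ : [v, a, c, b, d, u, w].Nodup := by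
    rw [nodup_seven_iff]; clear hI noT t₁ t₂ t₃ t₄ i₁ i₂ i₃ i₄; grind
  have n₂ : [v, a, d, b, c, u, w].Nodup := by
    rw [nodup_seven_iff]; clear hI noT t₁ t₂ t₃ t₄ i₁ i₂ i₃ i₄; grind
  -- Four vertices without triangle and independent triple have a perfect matching.
  have key : (G.Adj a b ∧ G.Adj c d) ∨ (G.Adj a c ∧ G.Adj b d) ∨ (G.Adj a d ∧ G.Adj b c) := by
    clear hI noT hn hn₀ n₁ n₂ nva nvb nvc nvd nvu nvw nab nac nad nau naw nbc nbd nbu nbw ncd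
      ncu ncw ndu ndw nuw
    grind
  rcases key with ⟨h, h'⟩ | ⟨h, h'⟩ | ⟨h, h'⟩
  · exact moserSpindle_isContained_of_matching hn₀ hK hI ha hb hc hd h h' huw
  · exact moserSpindle_isContained_of_matching n₁ hK hI ha hc hb hd h h' huw
  · exact moserSpindle_isContained_of_matching n₂ hK hI ha hd hb hc h h' huw

end NoIndependentTriple

/-! ### Graphs on seven vertices without 3-colouring -/

section SevenVertices

lemma exists_mem_notMem_list {V : Type*} {s : Finset V} (l : List V) (hl : l.length < s.card) :
    ∃ x ∈ s, x ∉ l := by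
  classical
  obtain ⟨x, hx, hxl⟩ := Finset.exists_mem_notMem_of_card_lt_card
    (lt_of_le_of_lt l.toFinset_card_le hl)
  exact ⟨x, hx, by simpa using hxl⟩

variable {V : Type*} [Fintype V] {G : SimpleGraph V}

lemma exists_notMem_list (l : List V) (hl : l.length < Fintype.card V) : ∃ x, x ∉ l := by
  classical
  by_contra! h
  have h1 : (Finset.univ : Finset V) ⊆ l.toFinset := fun x _ => by simpa using h x
  have h2 := (Finset.card_le_card h1).trans l.toFinset_card_le
  rw [Finset.card_univ] at h2
  omega

lemma isContained_of_independent (hV : Fintype.card V = 7) (hG : ¬ G.Colorable 3) {a b c : V}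
    (nab : a ≠ b) (nac : a ≠ c) (nbc : b ≠ c) (hab : ¬ G.Adj a b) (hac : ¬ G.Adj a c)
    (hbc : ¬ G.Adj b c) :
    completeGraph (Fin 4) ⊑ G ∨ wheelFive ⊑ G ∨ cappedSun ⊑ G := by
  classical
  obtain ⟨x, hx⟩ := exists_notMem_list [a, b, c] (by simp [hV])
  obtain ⟨y, hy⟩ := exists_notMem_list [a, b, c, x] (by simp [hV])
  obtain ⟨z, hz⟩ := exists_notMem_list [a, b, c, x, y] (by simp [hV])
  obtain ⟨w, hw⟩ := exists_notMem_list [a, b, c, x, y, z] (by simp [hV])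
  simp only [List.mem_cons, List.not_mem_nil, or_false, not_or] at hx hy hz hw
  have hn : [a, b, c, x, y, z, w].Nodup := by
    rw [nodup_seven_iff]
    grind
  have hcov : ∀ v, v = a ∨ v = b ∨ v = c ∨ v = x ∨ v = y ∨ v = z ∨ v = w := by
    intro v
    have h1 : [a, b, c, x, y, z, w].toFinset = Finset.univ := by
      rw [← Finset.card_eq_iff_eq_univ, List.toFinset_card_of_nodup hn, hV]
      simp
    have h2 : v ∈ [a, b, c, x, y, z, w].toFinset := by rw [h1]; simp
    simpa using h2
  let D : Set V := {v | v = x ∨ v = y ∨ v = z ∨ v = w}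
  have hD : ∀ v, v ∈ D ↔ v = x ∨ v = y ∨ v = z ∨ v = w := fun v => Iff.rfl
  have hI : ∀ u v, u ∉ D → v ∉ D → ¬ G.Adj u v := by
    have hout : ∀ v, v ∉ D → v = a ∨ v = b ∨ v = c := by
      intro v hv
      rw [hD] at hv
      have := hcov v
      grind
    intro u v hu hv huv
    rcases hout u hu with rfl | rfl | rfl <;> rcases hout v hv with rfl | rfl | rfl <;>
      first
      | exact huv.ne rfl
      | exact hab huv
      | exact hab huv.symm
      | exact hac huv
      | exact hac huv.symm
      | exact hbc huv
      | exact hbc huv.symm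
  rw [nodup_seven_iff] at hn
  obtain ⟨-, -, -, ⟨nxy, nxz, nxw⟩, ⟨nyz, nyw⟩, nzw⟩ := hn
  rcases exists_triangle_of_not_colorable hG hD hI with ⟨h₁, h₂, h₃⟩ | ⟨h₁, h₂, h₃⟩ |
    ⟨h₁, h₂, h₃⟩ | ⟨h₁, h₂, h₃⟩
  · exact isContained_of_triangle hG h₁ h₂ h₃ ⟨nxw.symm, nyw.symm, nzw.symm⟩ hD hI
  · exact isContained_of_triangle hG h₁ h₂ h₃ ⟨nxz.symm, nyz.symm, nzw⟩
      (fun v => (hD v).trans (iff_of_eq (by ac_rfl))) hI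
  · exact isContained_of_triangle hG h₁ h₂ h₃ ⟨nxy.symm, nyz, nyw⟩
      (fun v => (hD v).trans (iff_of_eq (by ac_rfl))) hI
  · exact isContained_of_triangle hG h₁ h₂ h₃ ⟨nxy, nxz, nxw⟩
      (fun v => (hD v).trans (iff_of_eq (by ac_rfl))) hI

/-- Nonneighbours of a vertex form a clique, so there are at most three and all degrees are at least
three. Not all equal three, since the degree sum 21 would be odd. -/
lemma exists_degree_of_no_independent [DecidableRel G.Adj] (hV : Fintype.card V = 7)
    (hK : ¬ completeGraph (Fin 4) ⊑ G)
    (hI : ∀ {p q r}, p ≠ q → p ≠ r → q ≠ r → G.Adj p q ∨ G.Adj p r ∨ G.Adj q r) :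
    ∃ v, 4 ≤ G.degree v := by
  classical
  by_contra! hlt
  have hdeg : ∀ v, G.degree v = 3 := by
    intro v
    refine le_antisymm (Nat.lt_succ_iff.mp (hlt v)) ?_
    by_contra! hv
    let s : Finset V := (insert v (G.neighborFinset v))ᶜ
    have hs : 4 ≤ s.card := by
      have h1 := Finset.card_insert_le v (G.neighborFinset v)
      rw [card_neighborFinset_eq_degree] at h1
      have h2 : s.card = Fintype.card V - _ := Finset.card_compl _
      omega
    have hmem : ∀ {x}, x ∈ s → x ≠ v ∧ ¬ G.Adj v x := by
      intro x hx
      simpa [s] using hx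
    obtain ⟨p, hp, -⟩ := exists_mem_notMem_list (s := s) [] (lt_of_lt_of_le (by simp) hs)
    obtain ⟨q, hq, hq'⟩ := exists_mem_notMem_list (s := s) [p] (lt_of_lt_of_le (by simp) hs)
    obtain ⟨r, hr, hr'⟩ := exists_mem_notMem_list (s := s) [p, q] (lt_of_lt_of_le (by simp) hs)
    obtain ⟨t, ht, ht'⟩ := exists_mem_notMem_list (s := s) [p, q, r] (lt_of_lt_of_le (by simp) hs)
    simp only [List.mem_cons, List.not_mem_nil, or_false, not_or] at hq' hr' ht'
    have adj : ∀ {x y}, x ∈ s → y ∈ s → x ≠ y → G.Adj x y := by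
      intro x y hx hy hxy
      rcases hI (hmem hx).1.symm (hmem hy).1.symm hxy with h | h | h
      exacts [absurd h (hmem hx).2, absurd h (hmem hy).2, h]
    exact hK (completeGraph_four_isContained (adj hp hq (Ne.symm hq'))
      (adj hp hr (Ne.symm hr'.1)) (adj hp ht (Ne.symm ht'.1)) (adj hq hr (Ne.symm hr'.2))
      (adj hq ht (Ne.symm ht'.2.1)) (adj hr ht (Ne.symm ht'.2.2)))
  have hsum := G.sum_degrees_eq_twice_card_edges
  simp only [hdeg, Finset.sum_const, Finset.card_univ, hV, smul_eq_mul] at hsum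
  omega

/-- A graph on seven vertices without 3-colouring contains a 4-critical graph. -/
theorem isContained_of_not_colorable (hV : Fintype.card V = 7) (hG : ¬ G.Colorable 3) :
    completeGraph (Fin 4) ⊑ G ∨ wheelFive ⊑ G ∨ moserSpindle ⊑ G ∨ cappedSun ⊑ G := by
  classical
  by_cases hind : ∃ a b c, a ≠ b ∧ a ≠ c ∧ b ≠ c ∧ ¬ G.Adj a b ∧ ¬ G.Adj a c ∧ ¬ G.Adj b c
  · obtain ⟨a, b, c, h₁, h₂, h₃, h₄, h₅, h₆⟩ := hind
    rcases isContained_of_independent hV hG h₁ h₂ h₃ h₄ h₅ h₆ with h | h | h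
    exacts [Or.inl h, Or.inr (Or.inl h), Or.inr (Or.inr (Or.inr h))]
  have hI : ∀ {p q r}, p ≠ q → p ≠ r → q ≠ r → G.Adj p q ∨ G.Adj p r ∨ G.Adj q r := by
    intro p q r h₁ h₂ h₃
    by_contra! h
    exact hind ⟨p, q, r, h₁, h₂, h₃, h⟩
  by_cases hK : completeGraph (Fin 4) ⊑ G
  · exact Or.inl hK
  obtain ⟨v, hv⟩ := exists_degree_of_no_independent hV hK hI
  rw [← card_neighborFinset_eq_degree] at hv
  have hadj : ∀ {x}, x ∈ G.neighborFinset v → G.Adj v x := by simp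
  obtain ⟨a, ha, -⟩ := exists_mem_notMem_list (s := G.neighborFinset v) []
    (lt_of_lt_of_le (by simp) hv)
  obtain ⟨b, hb, hb'⟩ := exists_mem_notMem_list (s := G.neighborFinset v) [a]
    (lt_of_lt_of_le (by simp) hv)
  obtain ⟨c, hc, hc'⟩ := exists_mem_notMem_list (s := G.neighborFinset v) [a, b]
    (lt_of_lt_of_le (by simp) hv)
  obtain ⟨d, hd, hd'⟩ := exists_mem_notMem_list (s := G.neighborFinset v) [a, b, c]
    (lt_of_lt_of_le (by simp) hv)
  replace ha := hadj ha
  replace hb := hadj hb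
  replace hc := hadj hc
  replace hd := hadj hd
  have h₁ := ha.ne
  have h₂ := hb.ne
  have h₃ := hc.ne
  have h₄ := hd.ne
  simp only [List.mem_cons, List.not_mem_nil, or_false, not_or] at hb' hc' hd'
  by_cases hfive : ∃ e, e ∉ [a, b, c, d] ∧ G.Adj v e
  · obtain ⟨e, he', he⟩ := hfive
    simp only [List.mem_cons, List.not_mem_nil, or_false, not_or] at he'
    have h₅ := he.ne
    refine Or.inr (Or.inl (wheelFive_isContained_of_five ?_ hK hI ha hb hc hd he))
    rw [nodup_six_iff]
    clear hI
    grind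
  · obtain ⟨u, hu⟩ := exists_notMem_list [v, a, b, c, d] (by simp [hV])
    obtain ⟨w, hw⟩ := exists_notMem_list [v, a, b, c, d, u] (by simp [hV])
    simp only [List.mem_cons, List.not_mem_nil, or_false, not_or, not_exists, not_and]
      at hu hw hfive
    have hvu := hfive u hu.2
    have hvw := hfive w ⟨hw.2.1, hw.2.2.1, hw.2.2.2.1, hw.2.2.2.2.1⟩
    -- Otherwise `v`, `u`, `w` would be independent.
    have huw : G.Adj u w := by
      rcases hI (Ne.symm hu.1) (Ne.symm hw.1) (Ne.symm hw.2.2.2.2.2) with h | h | h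
      exacts [absurd h hvu, absurd h hvw, h]
    refine Or.inr (Or.inr (Or.inl (moserSpindle_isContained_of_four ?_ hK hI ha hb hc hd huw)))
    rw [nodup_seven_iff]
    clear hI hfive
    grind

end SevenVertices

/-! ### Classification up to isomorphism -/

section Main

lemma IsEdgeCritical.isColorCritical {V W : Type*} {G : SimpleGraph V} {F : SimpleGraph W}
    {m : ℕ} (h : F.IsEdgeCritical m) (e : G ≃g F) : G.IsColorCritical (m + 1) :=
  isColorCritical_of_iso e h.1 h.2.1 h.2.2.1 h.2.2.2

/-- A critical graph with three more vertices than colours arises from one on seven vertices. -/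
lemma IsColorCritical.nonempty_iso_addSimplicial {V : Type*} [Fintype V] {G : SimpleGraph V}
    {k : ℕ} (h : G.IsColorCritical (3 + k + 1)) (hV : Fintype.card V = 7 + k) {s : Finset V}
    (hs : s.card = 7) (hsv : ∀ v ∉ s, ∀ w, v ≠ w → G.Adj v w) :
    Nonempty (G ≃g moserSpindle.addSimplicial k) ∨ Nonempty (G ≃g cappedSun.addSimplicial k) := by
  have hcard : Fintype.card V = s.card + k := by rw [hs, hV]
  have hind : ¬ (G.induce (s : Set V)).Colorable 3 := fun hc =>
    h.not_colorable (hc.of_induce hcard)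
  have key : ∀ {n : ℕ} {F : SimpleGraph (Fin n)}, ¬ F.Colorable 3 → F ⊑ G.induce (s : Set V) →
      Nonempty (G ≃g F.addSimplicial k) := fun hF hFG =>
    h.nonempty_iso (fun hc => hF hc.of_addSimplicial) (hFG.addSimplicial hcard hsv)
  -- Counting vertices rules out K₄ and the wheel.
  have size : ∀ {n : ℕ} {F : SimpleGraph (Fin n)}, Nonempty (G ≃g F.addSimplicial k) → n = 7 := by
    rintro n F ⟨e⟩
    have := Fintype.card_congr e.toEquiv
    simp only [Fintype.card_sum, Fintype.card_fin] at this
    omega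
  rcases isContained_of_not_colorable (by simpa using hs) hind with hF | hF | hF | hF
  · have := size (key not_colorable_completeGraph_four hF)
    omega
  · have := size (key not_colorable_wheelFive hF)
    omega
  · exact Or.inl (key not_colorable_moserSpindle hF)
  · exact Or.inr (key not_colorable_cappedSun hF)

/-- Independent triples avoid simplicial vertices. The spindle has none, while the apexes 3, 4, 5 of
the sun form one. -/
lemma isEmpty_moserSpindle_iso_cappedSun (k : ℕ) :
    IsEmpty (moserSpindle.addSimplicial k ≃g cappedSun.addSimplicial k) := by
  constructor
  intro e
  have tri : ∀ a b c : Fin 7, a ≠ b → a ≠ c → b ≠ c →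
      moserSpindle.Adj a b ∨ moserSpindle.Adj a c ∨ moserSpindle.Adj b c := by decide
  have tri' : ∀ x y z : Fin 7 ⊕ Fin k, x ≠ y → x ≠ z → y ≠ z →
      (moserSpindle.addSimplicial k).Adj x y ∨ (moserSpindle.addSimplicial k).Adj x z ∨
      (moserSpindle.addSimplicial k).Adj y z := by
    rintro (x | x) (y | y) (z | z) hxy hxz hyz <;> simp_all
  have hadj : ∀ {i j : Fin 7}, ¬ cappedSun.Adj i j →
      ¬ (moserSpindle.addSimplicial k).Adj (e.symm (Sum.inl i)) (e.symm (Sum.inl j)) := by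
    intro i j hij h
    rw [e.symm.map_adj_iff] at h
    exact hij (addSimplicial_inl_inl.mp h)
  have hne : ∀ {i j : Fin 7}, i ≠ j → e.symm (Sum.inl i) ≠ e.symm (Sum.inl j) := by
    intro i j hij h
    exact hij (Sum.inl.inj (e.symm.injective h))
  rcases tri' (e.symm (Sum.inl 3)) (e.symm (Sum.inl 4)) (e.symm (Sum.inl 5)) (hne (by decide))
    (hne (by decide)) (hne (by decide)) with h | h | h
  · exact hadj (by decide) h
  · exact hadj (by decide) h
  · exact hadj (by decide) h

/-- Adding no vertices changes nothing. -/
def addSimplicialZero {V : Type*} (G : SimpleGraph V) : G.addSimplicial 0 ≃g G where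
  toEquiv := Equiv.sumEmpty V (Fin 0)
  map_rel_iff' := by
    rintro (a | a) (b | b)
    · simp
    · exact b.elim0
    · exact a.elim0
    · exact a.elim0

end Main

end SimpleGraph

theorem mainTheorem6 (r : ℕ) (hr : 8 ≤ r) :
    -- up to isomorphism, the two graphs below are exactly the 4-critical graphs on 7 vertices
    (∀ (V : Type*) [Fintype V] (G : SimpleGraph V), Fintype.card V = 7 →
      (G.IsColorCritical 4 ↔
        Nonempty (G ≃g SimpleGraph.moserSpindle) ∨ Nonempty (G ≃g SimpleGraph.cappedSun))) ∧
    IsEmpty (SimpleGraph.moserSpindle ≃g SimpleGraph.cappedSun) ∧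
    -- up to isomorphism, there are exactly two r-critical graphs on r + 3 vertices, and they
    -- arise from those two graphs by adding r - 4 simplicial vertices
    (∀ (V : Type*) [Fintype V] (G : SimpleGraph V), Fintype.card V = r + 3 →
      (G.IsColorCritical r ↔
        Nonempty (G ≃g SimpleGraph.moserSpindle.addSimplicial (r - 4)) ∨
        Nonempty (G ≃g SimpleGraph.cappedSun.addSimplicial (r - 4)))) ∧
    IsEmpty (SimpleGraph.moserSpindle.addSimplicial (r - 4) ≃g
      SimpleGraph.cappedSun.addSimplicial (r - 4)) := by
  refine ⟨?_, ?_, ?_, SimpleGraph.isEmpty_moserSpindle_iso_cappedSun _⟩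
  · intro V _ G hV
    constructor
    · intro h
      rcases h.nonempty_iso_addSimplicial (k := 0) (s := Finset.univ) hV
        (by rw [Finset.card_univ, hV]) (by simp) with ⟨⟨e⟩⟩ | ⟨⟨e⟩⟩
      · exact Or.inl ⟨e.trans (SimpleGraph.addSimplicialZero _)⟩
      · exact Or.inr ⟨e.trans (SimpleGraph.addSimplicialZero _)⟩
    · rintro (⟨⟨e⟩⟩ | ⟨⟨e⟩⟩)
      · exact SimpleGraph.isEdgeCritical_moserSpindle.isColorCritical e
      · exact SimpleGraph.isEdgeCritical_cappedSun.isColorCritical e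
  · constructor
    intro e
    exact (SimpleGraph.isEmpty_moserSpindle_iso_cappedSun 0).false
      (((SimpleGraph.addSimplicialZero _).trans e).trans (SimpleGraph.addSimplicialZero _).symm)
  · intro V _ G hV
    obtain ⟨k, rfl⟩ : ∃ k, r = 3 + k + 1 := ⟨r - 4, by omega⟩
    rw [show 3 + k + 1 - 4 = k by omega]
    constructor
    · intro h
      classical
      -- The nonuniversal vertices, at most seven, are padded to exactly seven.
      obtain ⟨s, hs, hs'⟩ := Finset.exists_superset_card_eq (n := 7)
        (s := Finset.univ.filter fun v => ∃ w, Gᶜ.Adj v w)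
        (h.card_nonuniversal_le (by omega) (by omega) (by simp)) (by omega)
      refine h.nonempty_iso_addSimplicial (by omega) hs' fun v hv w hvw => ?_
      by_contra hadj
      exact hv (hs (by simpa using ⟨w, hvw, hadj⟩))
    · rintro (⟨⟨e⟩⟩ | ⟨⟨e⟩⟩)
      · exact (SimpleGraph.isEdgeCritical_moserSpindle.addSimplicial k).isColorCritical e
      · exact (SimpleGraph.isEdgeCritical_cappedSun.addSimplicial k).isColorCritical e
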